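/- Let $N\in\mathbb N$, $1\le p<\infty$, and let $K\subset\mathbb R^N$ be compact. All functions are real-valued and defined on all of $\mathbb R^N$. *Definitions.* For open $\Omega\subset\mathbb R^N$, write $u\in W^{1,p}(\Omega)$ if the restriction of $u$ to $\Omega$ and all its first order weak partial derivatives on $\Omega$ belong to $L^p(\Omega)$. Write $u\in V^{1,p}(\mathbb R^N)$ if $u\in L^p(\mathbb R^N)$ and every first order partial derivative of $u$ exists in the usual pointwise sense almost everywhere and belongs to $L^p(\mathbb R^N)$. For compact $F$ put $C_{1,p}(F)=\inf\{\sum_{|\alpha|\le1}\|D^\alpha\varphi\|_{L^p(\mathbb R^N)}:\varphi\in C_0^\infty(\mathbb R^N),\ \varphi\ge1\text{ on }F\}$, and for open $\omega$ put $C_{1,p}(\omega)=\sup\{C_{1,p}(F):F\subset\omega\text{ compact}\}$. A Lebesgue measurable function $u$ is *quasicontinuous* if for every $\varepsilon>0$ there is an open $\omega$ with $C_{1,p}(\omega)<\varepsilon$ such that $u|_{\mathbb R^N\setminus\omega}$ is continuous. The set $K$ has the *$J_p$-property* (respectively the *$J_p(\mathrm{cont})$-property*) if the quasicontinuous (respectively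 continuous) functions $u$ on $\mathbb R^N$ with $u\in W^{1,p}(K^c)$ are exactly the quasicontinuous (respectively continuous) functions in $W^{1,p}(\mathbb R^N)$. A function $s:\mathbb R\to\mathbb R$ is *singular* if it is continuous, not constant, and has derivative $0$ almost everywhere. A function $f$ on $\mathbb R^N$ is called *singular on a line* $t\mapsto y+tv$ ($v\neq0$) if $t\mapsto f(y+tv)$ has a nontrivial singular part, that is, if it is the sum of a locally absolutely continuous function and a singular function. It is *singular on a set of parallel lines of nonzero $(N-1)$-dimensional Lebesgue measure* if there is $v\ne0$ such that the set of those $y\in v^\perp$ for which $f$ is singular on the line $t\mapsto y+tv$ is not a null set for $(N-1)$-dimensional Lebesgue measure on the hyperplane $v^\perp$. **Corollary.** $K$ has the $J_p$-property (respectively the $J_p(\mathrm{cont})$-property) if and only if there is no quasicontinuous (respectively continuous) function $f\in V^{1,p}(\mathbb R^N)$ with $f\in W^{1,p}(K^c)$ which is singular on a set of parallel lines of nonzero $(N-1)$-dimensional Lebesgue measure. -/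

import Mathlib

open MeasureTheory Set
open scoped ENNReal

/-- Euclidean space `ℝ^N`. -/
abbrev RN (N : ℕ) : Type := EuclideanSpace ℝ (Fin N)

/-- The `j`-th standard unit vector of `ℝ^N`. -/
noncomputable abbrev unitVec {N : ℕ} (j : Fin N) : RN N := EuclideanSpace.single j (1 : ℝ)

/-- `φ` is a test function on the open set `Ω`, i.e. `φ ∈ C_0^∞(Ω)`. -/
def IsTestFunction {N : ℕ} (Ω : Set (RN N)) (φ : RN N → ℝ) : Prop :=
  ContDiff ℝ (⊤ : ℕ∞) φ ∧ HasCompactSupport φ ∧ tsupport φ ⊆ Ω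

/-- `g` is a weak `j`-th partial derivative of `u` on `Ω`. (It is only used below for `u` and `g`
in `L^p(Ω)` with `p ≥ 1`, so that both integrals converge.) -/
def IsWeakPartialDeriv {N : ℕ} (Ω : Set (RN N)) (j : Fin N) (u g : RN N → ℝ) : Prop :=
  ∀ φ : RN N → ℝ, IsTestFunction Ω φ →
    ∫ x in Ω, u x * fderiv ℝ φ x (unitVec j) = - ∫ x in Ω, g x * φ x

/-- The restriction of `u : ℝ^N → ℝ` to `Ω` belongs to the Sobolev space `W^{1,p}(Ω)`: `u` and all
its first order weak partial derivatives on `Ω` are in `L^p(Ω)`. -/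
def MemW {N : ℕ} (p : ℝ≥0∞) (Ω : Set (RN N)) (u : RN N → ℝ) : Prop :=
  MemLp u p (volume.restrict Ω) ∧
    ∀ j : Fin N, ∃ g : RN N → ℝ, MemLp g p (volume.restrict Ω) ∧ IsWeakPartialDeriv Ω j u g

/-- The rough Sobolev space `V^{1,p}(ℝ^N)`: `u` is in `L^p`, and each of its partial derivatives
exists in the usual pointwise sense at almost every point and is in `L^p`. -/
def MemV {N : ℕ} (p : ℝ≥0∞) (u : RN N → ℝ) : Prop :=
  MemLp u p volume ∧
    ∀ j : Fin N, (∀ᵐ x, LineDifferentiableAt ℝ u x (unitVec j)) ∧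
      MemLp (fun x => lineDeriv ℝ u x (unitVec j)) p volume

/-- The norm `∑_{|α| ≤ 1} ‖D^α φ‖_{L^p(ℝ^N)}` of a smooth function. -/
noncomputable def sobolevNorm {N : ℕ} (p : ℝ≥0∞) (φ : RN N → ℝ) : ℝ≥0∞ :=
  eLpNorm φ p volume + ∑ j : Fin N, eLpNorm (fun x => fderiv ℝ φ x (unitVec j)) p volume

/-- The capacity `C_{1,p}` of a compact set. -/
noncomputable def capCompact {N : ℕ} (p : ℝ≥0∞) (K : Set (RN N)) : ℝ≥0∞ :=
  ⨅ (φ : RN N → ℝ) (_ : IsTestFunction univ φ ∧ ∀ x ∈ K, 1 ≤ φ x), sobolevNorm p φ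

/-- The capacity `C_{1,p}` of an open set. -/
noncomputable def capOpen {N : ℕ} (p : ℝ≥0∞) (U : Set (RN N)) : ℝ≥0∞ :=
  ⨆ (K : Set (RN N)) (_ : IsCompact K ∧ K ⊆ U), capCompact p K

/-- The class `Q` of (Lebesgue measurable) functions on `ℝ^N` that are quasicontinuous with respect
to the capacity `C_{1,p}`. -/
def Quasicontinuous {N : ℕ} (p : ℝ≥0∞) (u : RN N → ℝ) : Prop :=
  AEMeasurable u volume ∧
    ∀ ε : ℝ≥0∞, 0 < ε → ∃ U : Set (RN N), IsOpen U ∧ capOpen p U < ε ∧ ContinuousOn u Uᶜ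

/-- The `J_p`-property: the quasicontinuous functions on `ℝ^N` that are `W^{1,p}` off `K` are
exactly the quasicontinuous functions in `W^{1,p}(ℝ^N)`. -/
def JProperty {N : ℕ} (p : ℝ≥0∞) (K : Set (RN N)) : Prop :=
  {u : RN N → ℝ | Quasicontinuous p u ∧ MemW p Kᶜ u} =
    {u : RN N → ℝ | Quasicontinuous p u ∧ MemW p univ u}

/-- The `J_p(cont)`-property: the same with continuous functions. -/
def JPropertyCont {N : ℕ} (p : ℝ≥0∞) (K : Set (RN N)) : Prop :=
  {u : RN N → ℝ | Continuous u ∧ MemW p Kᶜ u} =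
    {u : RN N → ℝ | Continuous u ∧ MemW p univ u}

/-- A singular function on the line: continuous, with derivative zero almost everywhere, and not
constant. -/
def IsSingularFunction (s : ℝ → ℝ) : Prop :=
  Continuous s ∧ (∀ᵐ t, HasDerivAt s 0 t) ∧ ¬ ∃ c : ℝ, ∀ t, s t = c

/-- `h : ℝ → ℝ` has a nontrivial singular part: it is the sum of a function that is absolutely
continuous on every compact interval and a singular function. -/
def HasSingularPart (h : ℝ → ℝ) : Prop :=
  ∃ g s : ℝ → ℝ, (∀ a b : ℝ, AbsolutelyContinuousOnInterval g a b) ∧ IsSingularFunction s ∧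
    ∀ t, h t = g t + s t

/-- `f` is singular on a set of parallel lines of nonzero `(N-1)`-dimensional Lebesgue measure.
The lines in the direction of `v ≠ 0` are `t ↦ y + t v` with `y` in the hyperplane `v^⊥`, and
a set of such lines is measured by the `(N-1)`-dimensional Lebesgue measure on `v^⊥`. -/
def SingularOnParallelLines {N : ℕ} (f : RN N → ℝ) : Prop :=
  ∃ v : RN N, v ≠ 0 ∧
    (volume : Measure ((Submodule.span ℝ {v})ᗮ : Submodule ℝ (RN N)))
      {y | HasSingularPart (fun t : ℝ => f ((y : RN N) + t • v))} ≠ 0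

/-! Both equivalences are instances of `removable_iff_not_exists_singular`, for a class `Q` that
contains all continuous functions and whose members are continuous on almost every line in each
direction. For quasicontinuous functions the latter holds because the capacity of an open set
controls the measure of its projections (`Quasicontinuous.continuousOnLines`).

If `K` is removable for `Q`, every candidate `f` lies in `W^{1,p}` of the whole space. On almost
every line it is then the integral of its weak derivative (`ae_sub_eq_integral`), hence locally
absolutely continuous. An absolutely continuous function with derivative zero almost everywhere is
constant, so no singular part can occur.

Conversely, let `u` be in `W^{1,p}` off `K` but not globally. A function of `V^{1,p}` with no
singular part on almost every coordinate line is the integral of its pointwise derivative there.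
Integration by parts and Fubini then make the pointwise partials weak partials. Hence any `V^{1,p}`
function continuous on lines and outside `W^{1,p}` is singular on lines
(`MemV.singularOnParallelLines`), and only membership in `V^{1,p}` is at stake.

If `K` is null, `u` itself is in `V^{1,p}`, because its weak derivatives off `K` are pointwise
derivatives almost everywhere (`ae_hasLineDerivAt`). If `K` has positive measure, `u` may fail to be
differentiable on `K` and is replaced by another function. A Lusin theorem for gradients in the
manner of Alberti (`exists_smooth_gradient_approx`), iterated, yields a continuous compactly
supported `f` whose derivative is a fixed coordinate form almost everywhere on `K`, while the `L^1`
norm of its first partial off `K` is at most half the measure of `K`. Were `f` in `W^{1,p}`, that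
partial would have integral zero over the whole space, which is impossible. -/

/-! ### Fubini along parallel lines. -/

/-- The hyperplane `v^⊥`. -/
noncomputable abbrev Perp {N : ℕ} (v : RN N) : Submodule ℝ (RN N) := (Submodule.span ℝ {v})ᗮ

/-- The parametrization `(y, t) ↦ y + t v` of `ℝ^N` by the lines parallel to `v`. -/
noncomputable def lineEquiv {N : ℕ} (v : RN N) (hv : v ≠ 0) : (Perp v × ℝ) ≃L[ℝ] RN N :=
  (LinearEquiv.ofBijective
    ((Perp v).subtype.coprod (LinearMap.toSpanSingleton ℝ (RN N) v)) (by
      constructor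
      · rw [← LinearMap.ker_eq_bot, LinearMap.ker_eq_bot']
        rintro ⟨y, t⟩ h
        simp only [LinearMap.coprod_apply, Submodule.subtype_apply,
          LinearMap.toSpanSingleton_apply] at h
        have h1 : inner ℝ v (y : RN N) = 0 :=
          (Submodule.mem_orthogonal_singleton_iff_inner_right.1 y.2)
        have h2 : inner ℝ v ((y : RN N) + t • v) = t * ‖v‖ ^ 2 := by
          rw [inner_add_right, h1, inner_smul_right, real_inner_self_eq_norm_sq, zero_add]
        rw [h, inner_zero_right] at h2
        have h3 : t = 0 := by
          have : ‖v‖ ^ 2 ≠ 0 := by simpa using hv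
          rcases mul_eq_zero.1 h2.symm with h | h
          · exact h
          · exact absurd h this
        subst h3
        simpa using h
      · intro x
        obtain ⟨a, ha, b, hb, rfl⟩ :=
          (Submodule.span ℝ {v}).exists_add_mem_mem_orthogonal x
        obtain ⟨t, rfl⟩ := Submodule.mem_span_singleton.1 ha
        exact ⟨(⟨b, hb⟩, t), by simp [add_comm]⟩)).toContinuousLinearEquiv

@[simp] lemma lineEquiv_apply {N : ℕ} (v : RN N) (hv : v ≠ 0) (z : Perp v × ℝ) :
    lineEquiv v hv z = (z.1 : RN N) + z.2 • v := rfl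

/-- A linear isomorphism carries Haar measure to Haar measure, which is unique up to a factor. The
value of the factor is never needed. -/
lemma exists_map_lineEquiv {N : ℕ} (v : RN N) (hv : v ≠ 0) :
    ∃ c : ℝ≥0∞, c ≠ 0 ∧ c ≠ ∞ ∧
      (volume : Measure (Perp v × ℝ)).map (lineEquiv v hv) = c • (volume : Measure (RN N)) := by
  have h1 : (volume : Measure (Perp v × ℝ)).IsAddHaarMeasure := by
    rw [Measure.volume_eq_prod]; infer_instance
  have h2 : ((volume : Measure (Perp v × ℝ)).map (lineEquiv v hv)).IsAddHaarMeasure :=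
    (lineEquiv v hv).isAddHaarMeasure_map _
  refine ⟨(Measure.addHaarScalarFactor ((volume : Measure (Perp v × ℝ)).map (lineEquiv v hv))
    (volume : Measure (RN N)) : ℝ≥0∞), ?_, ENNReal.coe_ne_top, ?_⟩
  · exact_mod_cast (Measure.addHaarScalarFactor_pos_of_isAddHaarMeasure _ _).ne'
  · exact Measure.isAddLeftInvariant_eq_smul _ _

lemma measurableEmbedding_lineEquiv {N : ℕ} (v : RN N) (hv : v ≠ 0) :
    MeasurableEmbedding (lineEquiv v hv) :=
  (lineEquiv v hv).toHomeomorph.measurableEmbedding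

lemma lineEquiv_quasiMeasurePreserving {N : ℕ} (v : RN N) (hv : v ≠ 0) :
    Measure.QuasiMeasurePreserving (lineEquiv v hv) volume volume := by
  obtain ⟨c, hc0, hc, h⟩ := exists_map_lineEquiv v hv
  refine ⟨(lineEquiv v hv).continuous.measurable, ?_⟩
  rw [h]
  exact Measure.smul_absolutelyContinuous

lemma ae_lineEquiv_iff {N : ℕ} (v : RN N) (hv : v ≠ 0) {P : RN N → Prop} :
    (∀ᵐ z : Perp v × ℝ, P (lineEquiv v hv z)) ↔ ∀ᵐ x, P x := by
  obtain ⟨c, hc0, hc, h⟩ := exists_map_lineEquiv v hv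
  rw [← (measurableEmbedding_lineEquiv v hv).ae_map_iff, h, Measure.ae_ennreal_smul_measure_iff hc0]

/-- A property that holds almost everywhere holds almost everywhere on almost every line. -/
lemma ae_line {N : ℕ} {v : RN N} (hv : v ≠ 0) {P : RN N → Prop} (h : ∀ᵐ x, P x) :
    ∀ᵐ y : Perp v, ∀ᵐ t : ℝ, P (y + t • v) := by
  have := (ae_lineEquiv_iff v hv).2 h
  rw [Measure.volume_eq_prod] at this
  exact Measure.ae_ae_of_ae_prod this

/-- Fubini needs a measurable set: the complement is replaced by a measurable subset that is almost
everywhere equal to it, whose slices are still null. -/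
lemma ae_prod_of_ae_ae {α β : Type*} [MeasurableSpace α] [MeasurableSpace β] {μ : Measure α}
    {ν : Measure β} [SFinite μ] [SFinite ν] {s : Set (α × β)} (hs : NullMeasurableSet s (μ.prod ν))
    (h : ∀ᵐ y ∂μ, ∀ᵐ t ∂ν, (y, t) ∈ s) : ∀ᵐ z ∂(μ.prod ν), z ∈ s := by
  obtain ⟨t, hts, ht, hst⟩ := hs.compl.exists_measurable_subset_ae_eq
  have : (μ.prod ν) t = 0 := by
    rw [Measure.measure_prod_null ht]
    filter_upwards [h] with y hy
    refine measure_mono_null ?_ hy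
    intro τ hτ
    exact hts hτ
  rw [ae_iff]
  change (μ.prod ν) sᶜ = 0
  rw [← measure_congr hst, this]

/-- Fubini's converse: a null measurable property that holds almost everywhere on almost every
line holds almost everywhere. -/
lemma ae_of_ae_line {N : ℕ} {v : RN N} (hv : v ≠ 0) {s : Set (RN N)} (hs : NullMeasurableSet s)
    (h : ∀ᵐ y : Perp v, ∀ᵐ t : ℝ, (y : RN N) + t • v ∈ s) : ∀ᵐ x, x ∈ s := by
  rw [← ae_lineEquiv_iff v hv]
  refine ae_prod_of_ae_ae (s := lineEquiv v hv ⁻¹' s) ?_ h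
  exact hs.preimage (lineEquiv_quasiMeasurePreserving v hv)

lemma integral_lineEquiv {N : ℕ} (v : RN N) (hv : v ≠ 0) :
    ∃ c : ℝ, c ≠ 0 ∧ ∀ F : RN N → ℝ, ∫ z : Perp v × ℝ, F (lineEquiv v hv z) = c * ∫ x, F x := by
  obtain ⟨c, hc0, hc, h⟩ := exists_map_lineEquiv v hv
  refine ⟨c.toReal, ENNReal.toReal_ne_zero.2 ⟨hc0, hc⟩, fun F => ?_⟩
  rw [← (measurableEmbedding_lineEquiv v hv).integral_map, h, integral_smul_measure, smul_eq_mul]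

lemma integrable_lineEquiv_iff {N : ℕ} (v : RN N) (hv : v ≠ 0) {F : RN N → ℝ} :
    Integrable (fun z : Perp v × ℝ => F (lineEquiv v hv z)) ↔ Integrable F := by
  obtain ⟨c, hc0, hc, h⟩ := exists_map_lineEquiv v hv
  change Integrable (F ∘ lineEquiv v hv) ↔ _
  rw [← (measurableEmbedding_lineEquiv v hv).integrable_map_iff, h, integrable_smul_measure hc0 hc]

lemma lintegral_line {N : ℕ} (v : RN N) (hv : v ≠ 0) :
    ∃ c : ℝ≥0∞, c ≠ ∞ ∧ ∀ F : RN N → ℝ≥0∞, Measurable F →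
      ∫⁻ y : Perp v, ∫⁻ t : ℝ, F (y + t • v) = c * ∫⁻ x, F x := by
  obtain ⟨c, hc0, hc, h⟩ := exists_map_lineEquiv v hv
  refine ⟨c, hc, fun F hF => ?_⟩
  have h1 := lintegral_map hF (lineEquiv v hv).continuous.measurable (μ := volume)
  have h2 := lintegral_prod (μ := (volume : Measure (Perp v))) (ν := (volume : Measure ℝ))
    (fun z => F (lineEquiv v hv z)) (hF.comp (lineEquiv v hv).continuous.measurable).aemeasurable
  rw [h, lintegral_smul_measure, smul_eq_mul, Measure.volume_eq_prod, h2] at h1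
  exact h1.symm

/-! ### Capacity, projections, and continuity on lines. -/

lemma sum_smul_unitVec {N : ℕ} (v : RN N) : ∑ j : Fin N, v j • (unitVec j : RN N) = v := by
  ext i
  simp [Finset.sum_apply, Pi.single_apply]

lemma fderiv_apply_eq_sum {N : ℕ} (L : RN N →L[ℝ] ℝ) (v : RN N) :
    L v = ∑ j : Fin N, v j * L (unitVec j) := by
  conv_lhs => rw [← sum_smul_unitVec v]
  simp

lemma continuous_fderiv_apply {N : ℕ} {φ : RN N → ℝ} (hφ : ContDiff ℝ (⊤ : ℕ∞) φ) (v : RN N) :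
    Continuous (fun x => fderiv ℝ φ x v) :=
  (hφ.continuous_fderiv (by simp)).clm_apply continuous_const

lemma eLpNorm_fderiv_apply_le {N : ℕ} {p : ℝ≥0∞} (hp : 1 ≤ p) {φ : RN N → ℝ}
    (hφ : ContDiff ℝ (⊤ : ℕ∞) φ) (v : RN N) :
    eLpNorm (fun x => fderiv ℝ φ x v) p volume ≤
      ‖v‖ₑ * ∑ j : Fin N, eLpNorm (fun x => fderiv ℝ φ x (unitVec j)) p volume := by
  have h1 : (fun x => fderiv ℝ φ x v)
      = ∑ j : Fin N, v j • (fun x => fderiv ℝ φ x (unitVec j)) := by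
    ext x
    rw [fderiv_apply_eq_sum]
    simp
  rw [h1, Finset.mul_sum]
  refine (eLpNorm_sum_le (fun j _ =>
    ((continuous_fderiv_apply hφ _).const_smul _).aestronglyMeasurable) hp).trans ?_
  refine Finset.sum_le_sum fun j _ => ?_
  rw [eLpNorm_const_smul]
  gcongr
  rw [enorm_le_iff_norm_le]
  exact PiLp.norm_apply_le v j

lemma hasDerivAt_line {N : ℕ} {φ : RN N → ℝ} (hφ : ContDiff ℝ (⊤ : ℕ∞) φ) (y v : RN N) (t : ℝ) :
    HasDerivAt (fun t : ℝ => φ (y + t • v)) (fderiv ℝ φ (y + t • v) v) t := by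
  have h1 : HasDerivAt (fun t : ℝ => y + t • v) v t := by
    simpa using ((hasDerivAt_id t).smul_const v).const_add y
  have h2 : HasFDerivAt φ (fderiv ℝ φ (y + t • v)) (y + t • v) :=
    (hφ.differentiable (by simp) _).hasFDerivAt
  exact h2.comp_hasDerivAt t h1

/-- On the unit interval starting at `t₀`, `|ψ|` is at least `1 - ∫ |ψ'|`, so `|ψ| + |ψ'|` has
integral at least 1 there. The interval carries a probability measure, so the `L^p` norm dominates
the `L^1` norm. -/
lemma one_le_lintegral_of_one_le {p : ℝ≥0∞} (hp : 1 ≤ p) (hp' : p ≠ ∞) {ψ ψ' : ℝ → ℝ}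
    (h : ∀ t, HasDerivAt ψ (ψ' t) t) (hc : Continuous ψ') {t₀ : ℝ} (h0 : 1 ≤ ψ t₀) :
    1 ≤ ∫⁻ t, ‖|ψ t| + |ψ' t|‖ₑ ^ p.toReal := by
  have hψ : Continuous ψ := continuous_iff_continuousAt.2 fun t => (h t).continuousAt
  set H : ℝ → ℝ := fun t => |ψ t| + |ψ' t| with hH
  have hHc : Continuous H := hψ.abs.add hc.abs
  have key : 1 ≤ ∫ t in t₀..(t₀ + 1), H t := by
    have e1 : ∀ s ∈ Icc t₀ (t₀ + 1), 1 - (∫ t in t₀..(t₀ + 1), |ψ' t|) ≤ |ψ s| := by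
      intro s hs
      have e2 : ∫ t in t₀..s, ψ' t = ψ s - ψ t₀ :=
        intervalIntegral.integral_eq_sub_of_hasDerivAt (fun t _ => h t)
          (hc.intervalIntegrable _ _)
      have e3 : |∫ t in t₀..s, ψ' t| ≤ ∫ t in t₀..s, |ψ' t| :=
        intervalIntegral.abs_integral_le_integral_abs hs.1
      have e4 : ∫ t in t₀..s, |ψ' t| ≤ ∫ t in t₀..(t₀ + 1), |ψ' t| :=
        intervalIntegral.integral_mono_interval le_rfl hs.1 hs.2
          (Filter.Eventually.of_forall fun t => abs_nonneg _)
          (hc.abs.intervalIntegrable _ _)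
      have e5 := neg_abs_le (∫ t in t₀..s, ψ' t)
      have e6 := le_abs_self (ψ s)
      linarith
    have e7 := intervalIntegral.integral_mono_on (μ := volume) (by linarith : t₀ ≤ t₀ + 1)
      (continuous_const.intervalIntegrable _ _) (hψ.abs.intervalIntegrable _ _) e1
    rw [intervalIntegral.integral_const] at e7
    rw [hH, intervalIntegral.integral_add (hψ.abs.intervalIntegrable _ _)
      (hc.abs.intervalIntegrable _ _)]
    simp only [add_sub_cancel_left, one_smul] at e7
    linarith
  have hp0 : p ≠ 0 := (zero_lt_one.trans_le hp).ne'
  set μ : Measure ℝ := volume.restrict (Ioc t₀ (t₀ + 1)) with hμ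
  have hprob : IsProbabilityMeasure μ := ⟨by simp [hμ]⟩
  have k1 : 1 ≤ eLpNorm H 1 μ := by
    rw [intervalIntegral.integral_of_le (by linarith)] at key
    have : ENNReal.ofReal (∫ t in Ioc t₀ (t₀ + 1), H t) ≤ eLpNorm H 1 μ := by
      rw [eLpNorm_one_eq_lintegral_enorm]
      refine le_trans ?_ (enorm_integral_le_lintegral_enorm H)
      rw [← ofReal_norm]
      exact ENNReal.ofReal_le_ofReal (le_abs_self _)
    refine le_trans ?_ this
    simpa using ENNReal.ofReal_le_ofReal key
  have k2 : 1 ≤ eLpNorm H p volume :=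
    k1.trans ((eLpNorm_le_eLpNorm_of_exponent_le hp hHc.aestronglyMeasurable).trans
      (eLpNorm_mono_measure _ Measure.restrict_le_self))
  rw [eLpNorm_eq_lintegral_rpow_enorm_toReal hp0 hp'] at k2
  by_contra hcon
  push Not at hcon
  have := ENNReal.rpow_lt_one hcon (z := 1 / p.toReal)
    (by have := ENNReal.toReal_pos hp0 hp'; positivity)
  exact absurd k2 (not_le.2 this)

/-- The projection of a set to `v^⊥` along `v`. -/
def lineProj {N : ℕ} (v : RN N) (s : Set (RN N)) : Set (Perp v) :=
  {y | ∃ t : ℝ, (y : RN N) + t • v ∈ s}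

/-- The measure of a projection of a compact set is controlled by its capacity. -/
lemma volume_lineProj_le {N : ℕ} {p : ℝ≥0∞} (hp : 1 ≤ p) (hp' : p ≠ ∞) (v : RN N) (hv : v ≠ 0) :
    ∃ C : ℝ≥0∞, C ≠ ∞ ∧ ∀ (F : Set (RN N)) (a : ℝ≥0∞), capCompact p F < a →
      volume (lineProj v F) ≤ C * a ^ p.toReal := by
  obtain ⟨c, hc, hint⟩ := lintegral_line v hv
  have hp0 : p ≠ 0 := (zero_lt_one.trans_le hp).ne'
  have hpr : 0 < p.toReal := ENNReal.toReal_pos hp0 hp'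
  refine ⟨c * (1 + ‖v‖ₑ) ^ p.toReal, ENNReal.mul_ne_top hc
    (ENNReal.rpow_ne_top_of_nonneg hpr.le (by simp)), fun F a ha => ?_⟩
  obtain ⟨φ, hφ⟩ := iInf_lt_iff.1 ha
  obtain ⟨⟨⟨hφ1, hφ2, -⟩, hφ3⟩, hφ4⟩ := iInf_lt_iff.1 hφ
  set D : RN N → ℝ := fun x => fderiv ℝ φ x v with hD
  have hDc : Continuous D := continuous_fderiv_apply hφ1 v
  set H : RN N → ℝ := fun x => |φ x| + |D x| with hH
  have hHc : Continuous H := hφ1.continuous.abs.add hDc.abs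
  have h1 : eLpNorm H p volume ≤ (1 + ‖v‖ₑ) * sobolevNorm p φ := by
    have := eLpNorm_add_le (hφ1.continuous.abs.aestronglyMeasurable (μ := volume))
      (hDc.abs.aestronglyMeasurable (μ := volume)) hp
    refine this.trans ?_
    have e1 : eLpNorm (fun x => |φ x|) p volume = eLpNorm φ p volume := eLpNorm_norm φ
    have e2 : eLpNorm (fun x => |D x|) p volume = eLpNorm D p volume := eLpNorm_norm D
    rw [e1, e2, add_mul, one_mul]
    refine add_le_add le_self_add ((eLpNorm_fderiv_apply_le hp hφ1 v).trans ?_)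
    gcongr
    exact le_add_self
  have hmeas : Measurable fun x => ‖H x‖ₑ ^ p.toReal :=
    (hHc.measurable.enorm).pow_const _
  have h2 : volume (lineProj v F) ≤ ∫⁻ y : Perp v, ∫⁻ t : ℝ, ‖H (y + t • v)‖ₑ ^ p.toReal := by
    have hm : Measurable fun y : Perp v => ∫⁻ t : ℝ, ‖H (y + t • v)‖ₑ ^ p.toReal :=
      (hmeas.comp (lineEquiv v hv).continuous.measurable).lintegral_prod_right'
    -- Chebyshev at level 1: each line that meets `F` contributes at least 1 to the outer integrand.
    refine le_trans (measure_mono ?_) (meas_ge_le_lintegral_div hm.aemeasurable one_ne_zero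
      ENNReal.one_ne_top |>.trans (by simp))
    rintro y ⟨t₀, ht₀⟩
    exact one_le_lintegral_of_one_le hp hp' (fun t => hasDerivAt_line hφ1 y v t)
      (hDc.comp (by fun_prop)) (hφ3 _ ht₀)
  rw [hint _ hmeas] at h2
  refine h2.trans ?_
  rw [mul_assoc]
  gcongr
  have e3 : ∫⁻ x, ‖H x‖ₑ ^ p.toReal = eLpNorm H p volume ^ p.toReal := by
    rw [eLpNorm_eq_lintegral_rpow_enorm_toReal hp0 hp', one_div,
      ENNReal.rpow_inv_rpow hpr.ne']
  rw [e3, ← ENNReal.mul_rpow_of_nonneg _ _ hpr.le]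
  refine ENNReal.rpow_le_rpow (h1.trans ?_) hpr.le
  gcongr

/-- The open set is exhausted by an increasing sequence of compact sets, each of capacity at most
`capOpen p U`, and projections commute with the union. -/
lemma volume_lineProj_open_le {N : ℕ} {p : ℝ≥0∞} (hp : 1 ≤ p) (hp' : p ≠ ∞) (v : RN N)
    (hv : v ≠ 0) :
    ∃ C : ℝ≥0∞, C ≠ ∞ ∧ ∀ (U : Set (RN N)) (a : ℝ≥0∞), IsOpen U → capOpen p U < a →
      volume (lineProj v U) ≤ C * a ^ p.toReal := by
  obtain ⟨C, hC, h⟩ := volume_lineProj_le hp hp' v hv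
  refine ⟨C, hC, fun U a hU ha => ?_⟩
  obtain ⟨F, hF, hFU⟩ : IsSigmaCompact U := by
    have : SigmaCompactSpace U := by
      have := hU.locallyCompactSpace
      infer_instance
    exact isSigmaCompact_iff_sigmaCompactSpace.2 this
  have hA : ∀ n, IsCompact (accumulate F n) := fun n =>
    (finite_le_nat n).isCompact_biUnion fun i _ => hF i
  have h1 : lineProj v U = ⋃ n, lineProj v (accumulate F n) := by
    ext y
    simp only [lineProj, mem_ofPred_eq, mem_iUnion]
    rw [← hFU, ← iUnion_accumulate (s := F)]
    simp only [mem_iUnion]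
    exact exists_comm
  rw [h1, Monotone.measure_iUnion]
  · refine iSup_le fun n => h _ _ (lt_of_le_of_lt ?_ ha)
    refine le_iSup₂_of_le (accumulate F n) ⟨hA n, ?_⟩ le_rfl
    rw [← hFU]
    exact accumulate_subset_iUnion n
  · intro m n hmn y hy
    obtain ⟨t, ht⟩ := hy
    exact ⟨t, monotone_accumulate hmn ht⟩

/-- `u` is continuous along almost every line in the direction `v`. -/
def ContinuousOnLines {N : ℕ} (v : RN N) (u : RN N → ℝ) : Prop :=
  ∀ᵐ y : Perp v, Continuous fun t : ℝ => u (y + t • v)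

/-- A quasicontinuous function is continuous on almost every line. -/
lemma Quasicontinuous.continuousOnLines {N : ℕ} {p : ℝ≥0∞} (hp : 1 ≤ p) (hp' : p ≠ ∞)
    {u : RN N → ℝ} (hu : Quasicontinuous p u) (v : RN N) (hv : v ≠ 0) :
    ContinuousOnLines v u := by
  obtain ⟨C, hC, h⟩ := volume_lineProj_open_le hp hp' v hv
  have hp0 : p ≠ 0 := (zero_lt_one.trans_le hp).ne'
  have hpr : 0 < p.toReal := ENNReal.toReal_pos hp0 hp'
  rw [ContinuousOnLines, ae_iff]
  -- A line on which `u` is discontinuous meets every exceptional open set, so the bad lines have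
  -- measure at most `C * a ^ p` for each `a > 0`; now let `a` tend to 0.
  refine nonpos_iff_eq_zero.1 (ge_of_tendsto (x := nhdsWithin 0 (Ioi (0 : ℝ≥0∞)))
    (f := fun a : ℝ≥0∞ => C * a ^ p.toReal) ?_ ?_)
  · have h1 : Filter.Tendsto (fun a : ℝ≥0∞ => C * a ^ p.toReal) (nhds 0)
        (nhds (C * 0 ^ p.toReal)) :=
      ENNReal.Tendsto.const_mul ((ENNReal.continuous_rpow_const).tendsto 0) (Or.inr hC)
    rw [ENNReal.zero_rpow_of_pos hpr, mul_zero] at h1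
    exact h1.mono_left nhdsWithin_le_nhds
  · filter_upwards [self_mem_nhdsWithin] with a ha
    obtain ⟨U, hU, hUa, hcont⟩ := hu.2 a ha
    refine (measure_mono ?_).trans (h U a hU hUa)
    intro y hy
    by_contra hyU
    refine hy (hcont.comp_continuous (by fun_prop) fun t ht => hyU ⟨t, ht⟩)

/-! ### Smooth approximations of the indicator of an interval. -/

lemma deriv_smoothTransition_eq_zero {t : ℝ} (ht : t ∉ Icc (0 : ℝ) 1) :
    deriv Real.smoothTransition t = 0 := by
  rw [mem_Icc, not_and_or, not_le, not_le] at ht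
  rcases ht with h | h
  · have : Real.smoothTransition =ᶠ[nhds t] fun _ => 0 := by
      filter_upwards [Iio_mem_nhds h] with s hs
      exact Real.smoothTransition.zero_of_nonpos (le_of_lt hs)
    rw [this.deriv_eq, deriv_const]
  · have : Real.smoothTransition =ᶠ[nhds t] fun _ => 1 := by
      filter_upwards [Ioi_mem_nhds h] with s hs
      exact Real.smoothTransition.one_of_one_le (le_of_lt hs)
    rw [this.deriv_eq, deriv_const]

lemma continuous_deriv_smoothTransition : Continuous (deriv Real.smoothTransition) :=
  (Real.smoothTransition.contDiff (n := 1)).continuous_deriv le_rfl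

lemma hasDerivAt_smoothTransition (t : ℝ) :
    HasDerivAt Real.smoothTransition (deriv Real.smoothTransition t) t :=
  ((Real.smoothTransition.contDiff (n := 1)).differentiable (by simp) t).hasDerivAt

lemma hasCompactSupport_deriv_smoothTransition :
    HasCompactSupport (deriv Real.smoothTransition) :=
  HasCompactSupport.intro isCompact_Icc fun _ ht => deriv_smoothTransition_eq_zero ht

lemma integral_deriv_smoothTransition : ∫ t, deriv Real.smoothTransition t = 1 := by
  have h1 : ∫ t in (0 : ℝ)..1, deriv Real.smoothTransition t = 1 := by
    rw [intervalIntegral.integral_eq_sub_of_hasDerivAt (fun t _ => hasDerivAt_smoothTransition t)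
      (continuous_deriv_smoothTransition.intervalIntegrable _ _)]
    simp
  rw [← h1, intervalIntegral.integral_of_le zero_le_one, ← integral_Icc_eq_integral_Ioc,
    setIntegral_eq_integral_of_forall_compl_eq_zero]
  intro t ht
  exact deriv_smoothTransition_eq_zero ht

/-- A smooth approximation of the indicator function of `(q, r]`. -/
noncomputable def ramp (q r : ℝ) (n : ℕ) (t : ℝ) : ℝ :=
  Real.smoothTransition (n * (t - q)) - Real.smoothTransition (n * (t - r))

/-- The derivative of `ramp`. -/
noncomputable def rampDeriv (q r : ℝ) (n : ℕ) (t : ℝ) : ℝ :=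
  n * deriv Real.smoothTransition (n * (t - q)) - n * deriv Real.smoothTransition (n * (t - r))

lemma contDiff_ramp (q r : ℝ) (n : ℕ) : ContDiff ℝ (⊤ : ℕ∞) (ramp q r n) :=
  (Real.smoothTransition.contDiff.comp (by fun_prop)).sub
    (Real.smoothTransition.contDiff.comp (by fun_prop))

lemma hasDerivAt_ramp (q r : ℝ) (n : ℕ) (t : ℝ) :
    HasDerivAt (ramp q r n) (rampDeriv q r n t) t := by
  have h : ∀ q : ℝ, HasDerivAt (fun t : ℝ => Real.smoothTransition (n * (t - q)))
      (n * deriv Real.smoothTransition (n * (t - q))) t := fun q => by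
    have h1 : HasDerivAt (fun t : ℝ => (n : ℝ) * (t - q)) n t := by
      simpa using ((hasDerivAt_id t).sub_const q).const_mul (n : ℝ)
    rw [mul_comm]
    exact (hasDerivAt_smoothTransition _).comp t h1
  exact (h q).sub (h r)

lemma continuous_rampDeriv (q r : ℝ) (n : ℕ) : Continuous (rampDeriv q r n) := by
  have := continuous_deriv_smoothTransition
  unfold rampDeriv
  fun_prop

lemma ramp_eq_zero {q r : ℝ} (hqr : q ≤ r) {n : ℕ} (hn : 0 < n) {t : ℝ}
    (ht : t ∉ Icc q (r + 1 / n)) : ramp q r n t = 0 := by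
  have hn' : (0 : ℝ) < n := by exact_mod_cast hn
  rw [mem_Icc, not_and_or, not_le, not_le] at ht
  rcases ht with h | h
  · rw [ramp, Real.smoothTransition.zero_of_nonpos, Real.smoothTransition.zero_of_nonpos, sub_zero]
    · exact mul_nonpos_of_nonneg_of_nonpos hn'.le (by linarith)
    · exact mul_nonpos_of_nonneg_of_nonpos hn'.le (by linarith)
  · have h1 : 1 ≤ n * (t - r) := by
      have : 1 / (n : ℝ) < t - r := by linarith
      rw [div_lt_iff₀ hn'] at this
      linarith
    have h2 : 1 ≤ n * (t - q) := by nlinarith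
    rw [ramp, Real.smoothTransition.one_of_one_le h1, Real.smoothTransition.one_of_one_le h2,
      sub_self]

lemma rampDeriv_eq_zero {q r : ℝ} (hqr : q ≤ r) {n : ℕ} (hn : 0 < n) {t : ℝ}
    (ht : t ∉ Icc q (r + 1 / n)) : rampDeriv q r n t = 0 := by
  have : ramp q r n =ᶠ[nhds t] fun _ => 0 := by
    filter_upwards [isClosed_Icc.isOpen_compl.mem_nhds ht] with s hs
    exact ramp_eq_zero hqr hn hs
  rw [← (hasDerivAt_ramp q r n t).deriv, this.deriv_eq, deriv_const]

lemma tsupport_ramp_subset {q r : ℝ} (hqr : q ≤ r) {n : ℕ} (hn : 0 < n) :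
    tsupport (ramp q r n) ⊆ Icc q (r + 1 / n) :=
  closure_minimal (fun _ ht => by_contra fun h => ht (ramp_eq_zero hqr hn h)) isClosed_Icc

lemma abs_ramp_le (q r : ℝ) (n : ℕ) (t : ℝ) : |ramp q r n t| ≤ 1 := by
  have h1 := Real.smoothTransition.nonneg (n * (t - q))
  have h2 := Real.smoothTransition.nonneg (n * (t - r))
  have h3 := Real.smoothTransition.le_one (n * (t - q))
  have h4 := Real.smoothTransition.le_one (n * (t - r))
  rw [ramp, abs_le]
  constructor <;> linarith

lemma eventually_smoothTransition_nat_mul_eq_one {s : ℝ} (hs : 0 < s) :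
    ∀ᶠ n : ℕ in Filter.atTop, Real.smoothTransition (n * s) = 1 := by
  obtain ⟨k, hk⟩ := exists_nat_ge (1 / s)
  filter_upwards [Filter.eventually_ge_atTop k] with n hn
  refine Real.smoothTransition.one_of_one_le ?_
  rw [div_le_iff₀ hs] at hk
  have : (k : ℝ) ≤ n := by exact_mod_cast hn
  nlinarith

lemma eventually_ramp_eq_indicator {q r : ℝ} (hqr : q ≤ r) (t : ℝ) :
    ∀ᶠ n : ℕ in Filter.atTop, ramp q r n t = (Ioc q r).indicator (fun _ => 1) t := by
  rcases le_or_gt t q with h | h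
  · refine Filter.Eventually.of_forall fun n => ?_
    have hn : (0 : ℝ) ≤ n := n.cast_nonneg
    rw [indicator_of_notMem (by simp [h]), ramp, Real.smoothTransition.zero_of_nonpos,
      Real.smoothTransition.zero_of_nonpos, sub_zero]
    · exact mul_nonpos_of_nonneg_of_nonpos hn (by linarith)
    · exact mul_nonpos_of_nonneg_of_nonpos hn (by linarith)
  · rcases le_or_gt t r with h' | h'
    · filter_upwards [eventually_smoothTransition_nat_mul_eq_one (sub_pos.2 h)] with n hn
      have hn' : (0 : ℝ) ≤ n := n.cast_nonneg
      rw [indicator_of_mem (by exact ⟨h, h'⟩), ramp, hn, Real.smoothTransition.zero_of_nonpos,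
        sub_zero]
      exact mul_nonpos_of_nonneg_of_nonpos hn' (by linarith)
    · filter_upwards [eventually_smoothTransition_nat_mul_eq_one (sub_pos.2 h),
        eventually_smoothTransition_nat_mul_eq_one (sub_pos.2 h')] with n hn hn'
      rw [indicator_of_notMem (by simp [h']), ramp, hn, hn', sub_self]

/-- For `n > 0` the kernels have mass 1 and are supported in `[q, q + 1/n]`, so they form an
approximate identity at `q`. -/
lemma tendsto_integral_mul_smoothTransition {w : ℝ → ℝ} (hw : Continuous w) (q : ℝ) :
    Filter.Tendsto (fun n : ℕ => ∫ t, w t * (n * deriv Real.smoothTransition (n * (t - q))))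
      Filter.atTop (nhds (w q)) := by
  have h1 : ∀ n : ℕ, 0 < n → ∫ t, w t * (n * deriv Real.smoothTransition (n * (t - q)))
      = ∫ s, w (q + s / n) * deriv Real.smoothTransition s := by
    intro n hn
    have hn' : (0 : ℝ) < n := by exact_mod_cast hn
    have e1 := integral_sub_right_eq_self (μ := (volume : Measure ℝ))
      (fun t => w (q + t) * (n * deriv Real.smoothTransition (n * t))) q
    simp only [add_sub_cancel] at e1
    rw [e1]
    have e2 := Measure.integral_comp_mul_left
      (fun s => w (q + s / n) * deriv Real.smoothTransition s) (n : ℝ)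
    rw [abs_of_pos (inv_pos.2 hn'), smul_eq_mul] at e2
    rw [← mul_inv_cancel_left₀ hn'.ne' (∫ s, w (q + s / n) * deriv Real.smoothTransition s), ← e2,
      ← integral_const_mul]
    congr 1
    ext t
    rw [mul_div_cancel_left₀ _ hn'.ne']
    ring
  have h2 : Filter.Tendsto (fun n : ℕ => ∫ s, w (q + s / n) * deriv Real.smoothTransition s)
      Filter.atTop (nhds (∫ s, w q * deriv Real.smoothTransition s)) := by
    obtain ⟨M, hM⟩ := (isCompact_Icc (a := q) (b := q + 1)).exists_bound_of_continuousOn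
      hw.continuousOn
    refine tendsto_integral_filter_of_dominated_convergence
      (fun s => M * |deriv Real.smoothTransition s|) ?_ ?_ ?_ ?_
    · refine Filter.Eventually.of_forall fun n => ?_
      exact ((hw.comp (by fun_prop)).mul continuous_deriv_smoothTransition).aestronglyMeasurable
    · filter_upwards [Filter.eventually_ge_atTop 1] with n hn
      refine Filter.Eventually.of_forall fun s => ?_
      by_cases hs : s ∈ Icc (0 : ℝ) 1
      · rw [norm_mul, Real.norm_eq_abs (deriv _ _)]
        gcongr
        refine hM _ ⟨?_, ?_⟩
        · have : 0 ≤ s / n := div_nonneg hs.1 n.cast_nonneg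
          linarith
        · have : s / n ≤ 1 := div_le_one_of_le₀ (hs.2.trans (by exact_mod_cast hn)) n.cast_nonneg
          linarith
      · simp [deriv_smoothTransition_eq_zero hs]
    · exact (continuous_deriv_smoothTransition.abs.integrable_of_hasCompactSupport
        hasCompactSupport_deriv_smoothTransition.norm).const_mul M
    · refine Filter.Eventually.of_forall fun s => ?_
      refine Filter.Tendsto.mul_const _ ?_
      have : Filter.Tendsto (fun n : ℕ => q + s / n) Filter.atTop (nhds (q + 0)) :=
        (tendsto_const_div_atTop_nhds_zero_nat s).const_add q
      rw [add_zero] at this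
      exact (hw.tendsto q).comp this
  rw [integral_const_mul, integral_deriv_smoothTransition, mul_one] at h2
  refine h2.congr' ?_
  filter_upwards [Filter.eventually_gt_atTop 0] with n hn
  exact (h1 n hn).symm

lemma tendsto_integral_mul_ramp {γ : ℝ → ℝ} (hγ : LocallyIntegrable γ) {q r : ℝ} (hqr : q ≤ r) :
    Filter.Tendsto (fun n : ℕ => ∫ t, γ t * ramp q r n t)
      Filter.atTop (nhds (∫ t in q..r, γ t)) := by
  rw [intervalIntegral.integral_of_le hqr, ← integral_indicator measurableSet_Ioc]
  refine tendsto_integral_filter_of_dominated_convergence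
    ((Icc q (r + 1)).indicator fun t => |γ t|) ?_ ?_ ?_ ?_
  · refine Filter.Eventually.of_forall fun n => ?_
    exact hγ.aestronglyMeasurable.mul (contDiff_ramp q r n).continuous.aestronglyMeasurable
  · filter_upwards [Filter.eventually_ge_atTop 1] with n hn
    refine Filter.Eventually.of_forall fun t => ?_
    by_cases ht : t ∈ Icc q (r + 1)
    · rw [indicator_of_mem ht, norm_mul]
      exact mul_le_of_le_one_right (abs_nonneg _) (abs_ramp_le q r n t)
    · rw [indicator_of_notMem ht, ramp_eq_zero hqr (by omega), mul_zero, norm_zero]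
      intro h
      refine ht ⟨h.1, h.2.trans ?_⟩
      have : 1 / (n : ℝ) ≤ 1 := div_le_one_of_le₀ (by exact_mod_cast hn) n.cast_nonneg
      linarith
  · rw [integrable_indicator_iff measurableSet_Icc]
    exact (hγ.integrableOn_isCompact isCompact_Icc).norm
  · refine Filter.Eventually.of_forall fun t => ?_
    refine tendsto_nhds_of_eventually_eq ?_
    filter_upwards [eventually_ramp_eq_indicator hqr t] with n hn
    rw [hn]
    by_cases ht : t ∈ Ioc q r <;> simp [ht]

/-- Testing a weak derivative against ramps: `rampDeriv` tends to the point mass at `q` minus that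
at `r`, while `ramp` tends to the indicator of `(q, r]`. -/
lemma sub_eq_integral_of_ramp {w γ : ℝ → ℝ} (hw : Continuous w) (hγ : LocallyIntegrable γ)
    {q r : ℝ} (hqr : q ≤ r)
    (h : ∀ᶠ n : ℕ in Filter.atTop, ∫ t, (w t * rampDeriv q r n t + γ t * ramp q r n t) = 0) :
    w r - w q = ∫ t in q..r, γ t := by
  have h1 := ((tendsto_integral_mul_smoothTransition hw q).sub
    (tendsto_integral_mul_smoothTransition hw r)).add (tendsto_integral_mul_ramp hγ hqr)
  have h2 : w q - w r + ∫ t in q..r, γ t = 0 := by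
    refine tendsto_nhds_unique h1 (tendsto_nhds_of_eventually_eq ?_)
    filter_upwards [h, Filter.eventually_gt_atTop 0] with n hn hn0
    have hn' : (0 : ℝ) < n := by exact_mod_cast hn0
    have hint : ∀ q : ℝ, Integrable fun t => w t * (n * deriv Real.smoothTransition (n *
        (t - q))) := by
      intro q
      refine Continuous.integrable_of_hasCompactSupport ?_ ?_
      · have := continuous_deriv_smoothTransition
        fun_prop
      · refine HasCompactSupport.intro (isCompact_Icc (a := q) (b := q + 1 / n)) fun t ht => ?_
        rw [deriv_smoothTransition_eq_zero, mul_zero, mul_zero]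
        intro hs
        refine ht ⟨?_, ?_⟩
        · linarith [(mul_nonneg_iff_of_pos_left hn').1 hs.1]
        · have : t - q ≤ 1 / n := by
            rw [le_div_iff₀ hn']
            linarith [hs.2]
          linarith
    have hint2 : Integrable fun t => γ t * ramp q r n t := by
      have := hγ.integrable_smul_left_of_hasCompactSupport (contDiff_ramp q r n).continuous
        (HasCompactSupport.intro isCompact_Icc fun t ht => ramp_eq_zero hqr hn0 ht)
      simpa [mul_comm] using this
    have h3 := integral_add ((hint q).sub (hint r)) hint2
    simp only [Pi.sub_apply] at h3
    rw [← integral_sub (hint q) (hint r), ← h3, ← hn]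
    congr 1
    ext t
    simp only [rampDeriv]
    ring
  linarith

/-! ### Weak derivatives restricted to lines. -/

/-- `g` is a weak derivative of `u` on `Ω` in the direction `v`. -/
def IsWeakDirDeriv {N : ℕ} (Ω : Set (RN N)) (v : RN N) (u g : RN N → ℝ) : Prop :=
  ∀ φ : RN N → ℝ, IsTestFunction Ω φ →
    ∫ x in Ω, u x * fderiv ℝ φ x v = - ∫ x in Ω, g x * φ x

lemma MeasureTheory.LocallyIntegrable.integrable_mul_of_hasCompactSupport {N : ℕ}
    {μ : Measure (RN N)} {u : RN N → ℝ}
    (hu : LocallyIntegrable u μ) {ψ : RN N → ℝ} (hψ : Continuous ψ) (hc : HasCompactSupport ψ) :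
    Integrable (fun x => u x * ψ x) μ := by
  simpa [mul_comm] using hu.integrable_smul_left_of_hasCompactSupport hψ hc

lemma HasCompactSupport.fderiv_apply' {N : ℕ} {φ : RN N → ℝ} (h : HasCompactSupport φ) (v : RN N) :
    HasCompactSupport fun x => fderiv ℝ φ x v :=
  (h.fderiv ℝ).comp_left (g := fun L : RN N →L[ℝ] ℝ => L v) (by simp)

lemma locallyIntegrable_comp_lineEquiv {N : ℕ} {v : RN N} (hv : v ≠ 0) {u : RN N → ℝ}
    (hu : LocallyIntegrable u) :
    LocallyIntegrable (fun z : Perp v × ℝ => u (lineEquiv v hv z)) := by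
  rw [locallyIntegrable_iff]
  intro C hC
  have hm : MeasurableSet C := hC.measurableSet
  have hC' : IsCompact (lineEquiv v hv '' C) := hC.image (lineEquiv v hv).continuous
  have h1 := hu.integrableOn_isCompact hC'
  rw [← integrable_indicator_iff hC'.measurableSet, ← integrable_lineEquiv_iff v hv] at h1
  rw [← integrable_indicator_iff hm]
  refine h1.congr (Filter.Eventually.of_forall fun z => ?_)
  by_cases hz : z ∈ C
  · simp only
    rw [indicator_of_mem hz, indicator_of_mem (mem_image_of_mem _ hz)]
  · simp only
    rw [indicator_of_notMem hz, indicator_of_notMem]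
    rintro ⟨w, hw, h⟩
    exact hz ((lineEquiv v hv).injective h ▸ hw)

/-- This makes the slice integral `y ↦ ∫ f (y, t) dt` locally integrable, as the fundamental lemma
of the calculus of variations requires. -/
lemma MeasureTheory.LocallyIntegrable.integrableOn_prod_univ {α : Type*} [TopologicalSpace α]
    [MeasurableSpace α] {μ : Measure α} [SFinite μ]
    {f : α × ℝ → ℝ} (hf : LocallyIntegrable f (μ.prod volume)) {a b : ℝ}
    (h0 : ∀ z : α × ℝ, z.2 ∉ Icc a b → f z = 0) {C : Set α} (hC : IsCompact C) :
    Integrable f ((μ.restrict C).prod volume) := by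
  have h1 : IntegrableOn f (C ×ˢ Icc a b) (μ.prod volume) :=
    hf.integrableOn_isCompact (hC.prod isCompact_Icc)
  rw [IntegrableOn, ← Measure.prod_restrict] at h1
  have h2 : IntegrableOn f (univ ×ˢ Icc a b) ((μ.restrict C).prod volume) := by
    rw [IntegrableOn, ← Measure.prod_restrict, Measure.restrict_univ]
    exact h1
  rw [← integrableOn_univ]
  refine h2.of_forall_sdiff_eq_zero MeasurableSet.univ fun z hz => h0 z fun hz' => hz.2 ⟨trivial, hz'⟩

lemma MeasureTheory.LocallyIntegrable.ae_slice {α : Type*} [TopologicalSpace α]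
    [SigmaCompactSpace α] [MeasurableSpace α]
    {μ : Measure α} [SFinite μ]
    {f : α × ℝ → ℝ} (hf : LocallyIntegrable f (μ.prod volume)) :
    ∀ᵐ y ∂μ, LocallyIntegrable fun t => f (y, t) := by
  have h1 : ∀ m n : ℕ, ∀ᵐ y ∂μ, y ∈ compactCovering α m →
      IntegrableOn (fun t => f (y, t)) (Icc (-n : ℝ) n) := by
    intro m n
    have h1 : IntegrableOn f (compactCovering α m ×ˢ Icc (-n : ℝ) n) (μ.prod volume) :=
      hf.integrableOn_isCompact ((isCompact_compactCovering α m).prod isCompact_Icc)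
    rw [IntegrableOn, ← Measure.prod_restrict] at h1
    exact ae_imp_of_ae_restrict h1.prod_right_ae
  filter_upwards [ae_all_iff.2 fun m => ae_all_iff.2 fun n => h1 m n] with y hy
  obtain ⟨m, hm⟩ := mem_iUnion.1 ((iUnion_compactCovering α).symm ▸ mem_univ y)
  rw [locallyIntegrable_iff]
  intro C hC
  obtain ⟨R, hR⟩ := hC.isBounded.subset_closedBall 0
  obtain ⟨n, hn⟩ := exists_nat_ge R
  refine (hy m n hm).mono_set (hR.trans ?_)
  rw [Real.closedBall_eq_Icc]
  exact Icc_subset_Icc (by linarith) (by linarith)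

lemma isTestFunction_prod {N : ℕ} {v : RN N} (hv : v ≠ 0) {Ω : Set (RN N)} {B : Set (Perp v)}
    {a b : ℝ} (hB : ∀ y ∈ B, ∀ t ∈ Icc a b, (y : RN N) + t • v ∈ Ω) {α : Perp v → ℝ}
    (hα : ContDiff ℝ (⊤ : ℕ∞) α) (hαc : HasCompactSupport α) (hαB : tsupport α ⊆ B)
    {β : ℝ → ℝ} (hβ : ContDiff ℝ (⊤ : ℕ∞) β) (hβs : tsupport β ⊆ Icc a b) :
    IsTestFunction Ω fun x => α ((lineEquiv v hv).symm x).1 * β ((lineEquiv v hv).symm x).2 := by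
  have hK : IsCompact (lineEquiv v hv '' (tsupport α ×ˢ tsupport β)) :=
    (hαc.prod (isCompact_Icc.of_isClosed_subset (isClosed_tsupport β) hβs)).image
      (lineEquiv v hv).continuous
  have hsub : (tsupport fun x => α ((lineEquiv v hv).symm x).1 * β ((lineEquiv v hv).symm x).2) ⊆
      lineEquiv v hv '' (tsupport α ×ˢ tsupport β) := by
    refine closure_minimal (fun x hx => ?_) hK.isClosed
    refine ⟨(lineEquiv v hv).symm x, ⟨subset_tsupport _ ?_, subset_tsupport _ ?_⟩, by simp⟩
    · exact left_ne_zero_of_mul hx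
    · exact right_ne_zero_of_mul hx
  refine ⟨?_, hK.of_isClosed_subset (isClosed_tsupport _) hsub, hsub.trans ?_⟩
  · exact (hα.comp (contDiff_fst.comp (lineEquiv v hv).symm.contDiff)).mul
      (hβ.comp (contDiff_snd.comp (lineEquiv v hv).symm.contDiff))
  · rintro _ ⟨⟨y, t⟩, ⟨hy, ht⟩, rfl⟩
    exact hB y (hαB hy) t (hβs ht)

lemma integral_indicator_mul {α : Type*} [MeasurableSpace α] {μ : Measure α} {s : Set α}
    (hs : MeasurableSet s) (a b : α → ℝ) :
    ∫ x, s.indicator a x * b x ∂μ = ∫ x in s, a x * b x ∂μ := by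
  rw [← integral_indicator hs]
  congr 1
  ext x
  rw [indicator_mul_left]

/-- Test with products `α(y) β(t)`. By Fubini the slice integral is orthogonal to every smooth `α`
supported in `B`, hence vanishes almost everywhere on `B`. The cut-off of `u` to `Ω` can be dropped
because `β'` vanishes off `[a, b]`. -/
lemma ae_integral_line_eq_zero {N : ℕ} {v : RN N} (hv : v ≠ 0) {Ω : Set (RN N)} (hΩ : IsOpen Ω)
    {u g : RN N → ℝ} (hu : LocallyIntegrable (Ω.indicator u)) (hg : LocallyIntegrable
        (Ω.indicator g))
    (h : IsWeakDirDeriv Ω v u g) {B : Set (Perp v)} (hBo : IsOpen B) {a b : ℝ}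
    (hB : ∀ y ∈ B, ∀ t ∈ Icc a b, (y : RN N) + t • v ∈ Ω)
    {β β' : ℝ → ℝ} (hβ : ContDiff ℝ (⊤ : ℕ∞) β) (hβ' : ∀ t, HasDerivAt β (β' t) t)
    (hβ'c : Continuous β') (hβs : tsupport β ⊆ Icc a b) (hβ's : ∀ t, t ∉ Icc a b → β' t = 0) :
    ∀ᵐ y : Perp v, y ∈ B →
      ∫ t, (u (y + t • v) * β' t + Ω.indicator g (y + t • v) * β t) = 0 := by
  have hβ0 : ∀ t, t ∉ Icc a b → β t = 0 := fun t ht =>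
    image_eq_zero_of_notMem_tsupport fun h => ht (hβs h)
  set f : Perp v × ℝ → ℝ := fun z => Ω.indicator u (lineEquiv v hv z) * β' z.2 +
    Ω.indicator g (lineEquiv v hv z) * β z.2 with hf
  have hfl : LocallyIntegrable f := by
    have h1 := (locallyIntegrable_comp_lineEquiv hv hu).continuous_smul
      (hβ'c.comp (continuous_snd (X := Perp v)))
    have h2 := (locallyIntegrable_comp_lineEquiv hv hg).continuous_smul
      (hβ.continuous.comp (continuous_snd (X := Perp v)))
    refine (h1.add h2).congr (Filter.Eventually.of_forall fun z => ?_)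
    simp [hf, mul_comm]
  have hf0 : ∀ z : Perp v × ℝ, z.2 ∉ Icc a b → f z = 0 := fun z hz => by
    simp [hf, hβ0 _ hz, hβ's _ hz]
  have hfl' : LocallyIntegrable f ((volume : Measure (Perp v)).prod volume) := hfl
  set I : Perp v → ℝ := fun y => ∫ t, f (y, t) with hI
  have hIl : LocallyIntegrable I := by
    rw [locallyIntegrable_iff]
    intro C hC
    exact (hfl'.integrableOn_prod_univ hf0 hC).integral_prod_left
  have key : ∀ᵐ y : Perp v, y ∈ B → I y = 0 := by
    refine hBo.ae_eq_zero_of_integral_contDiff_smul_eq_zero (hIl.locallyIntegrableOn B) ?_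
    intro α hα hαc hαB
    set φ : RN N → ℝ := fun x => α ((lineEquiv v hv).symm x).1 * β ((lineEquiv v hv).symm x).2
      with hφ
    have hφt : IsTestFunction Ω φ := isTestFunction_prod hv hB hα hαc hαB hβ hβs
    have hφL : ∀ z, φ (lineEquiv v hv z) = α z.1 * β z.2 := fun z => by
      simp only [hφ, ContinuousLinearEquiv.symm_apply_apply]
    have hdφ : ∀ z, fderiv ℝ φ (lineEquiv v hv z) v = α z.1 * β' z.2 := by
      intro z
      have e1 := hasDerivAt_line hφt.1 (z.1 : RN N) v z.2
      have e2 : (fun t : ℝ => φ ((z.1 : RN N) + t • v)) = fun t => α z.1 * β t := by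
        ext t
        exact hφL (z.1, t)
      rw [e2] at e1
      exact e1.unique ((hβ' z.2).const_mul _)
    have hw := h φ hφt
    have i1 : Integrable fun x => Ω.indicator u x * fderiv ℝ φ x v :=
      hu.integrable_mul_of_hasCompactSupport (continuous_fderiv_apply hφt.1 v)
        (hφt.2.1.fderiv_apply' v)
    have i2 : Integrable fun x => Ω.indicator g x * φ x :=
      hg.integrable_mul_of_hasCompactSupport hφt.1.continuous hφt.2.1
    have hw' : ∫ x, (Ω.indicator u x * fderiv ℝ φ x v + Ω.indicator g x * φ x) = 0 := by
      rw [integral_add i1 i2, integral_indicator_mul hΩ.measurableSet,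
        integral_indicator_mul hΩ.measurableSet, hw]
      ring
    obtain ⟨c, hc, hint⟩ := integral_lineEquiv v hv
    have hw2 := hint fun x => Ω.indicator u x * fderiv ℝ φ x v + Ω.indicator g x * φ x
    rw [hw', mul_zero] at hw2
    have i3 : Integrable (fun z : Perp v × ℝ => α z.1 * f z)
        ((volume : Measure (Perp v)).prod volume) := by
      have := (integrable_lineEquiv_iff v hv).2 (i1.add i2)
      refine this.congr (Filter.Eventually.of_forall fun z => ?_)
      simp only [Pi.add_apply, hdφ, hφL, hf]
      ring
    have hw3 : ∫ z : Perp v × ℝ, α z.1 * f z = 0 := by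
      rw [← hw2]
      congr 1
      ext z
      simp only [hdφ, hφL, hf]
      ring
    rw [Measure.volume_eq_prod, integral_prod _ i3] at hw3
    simp only [integral_const_mul] at hw3
    simpa [hI] using hw3
  filter_upwards [key] with y hy hyB
  rw [← hy hyB]
  refine integral_congr_ae (Filter.Eventually.of_forall fun t => ?_)
  simp only [hf, lineEquiv_apply]
  by_cases ht : t ∈ Icc a b
  · rw [indicator_of_mem (hB y hyB t ht) u]
  · rw [hβ's t ht, mul_zero, mul_zero]

/-- A function that is continuous on almost every line parallel to `v` is the integral of its weak
derivative in the direction `v` along almost every such line. -/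
lemma ae_sub_eq_integral {N : ℕ} {v : RN N} (hv : v ≠ 0) {Ω : Set (RN N)} (hΩ : IsOpen Ω)
    {u g : RN N → ℝ} (hu : LocallyIntegrable (Ω.indicator u))
    (hg : LocallyIntegrable (Ω.indicator g))
    (h : IsWeakDirDeriv Ω v u g) (hcont : ContinuousOnLines v u) :
    ∀ᵐ y : Perp v, LocallyIntegrable (fun t : ℝ => Ω.indicator g (y + t • v)) ∧
      ∀ a b : ℝ, a ≤ b → (∀ t ∈ Icc a b, (y : RN N) + t • v ∈ Ω) →
        u (y + b • v) - u (y + a • v) = ∫ t in a..b, Ω.indicator g (y + t • v) := by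
  -- Basic open sets, rational endpoints and ramp indices form a countable family, so one null set
  -- of lines serves all of them.
  have hbox : ∀ B ∈ TopologicalSpace.countableBasis (Perp v), ∀ q r b : ℚ, ∀ n : ℕ,
      ∀ᵐ y : Perp v, q ≤ r → 0 < n → (r : ℝ) + 1 / n ≤ b →
      (∀ y ∈ B, ∀ t ∈ Icc (q : ℝ) b, (y : RN N) + t • v ∈ Ω) → y ∈ B →
      ∫ t, (u (y + t • v) * rampDeriv q r n t + Ω.indicator g (y + t • v) * ramp q r n t) = 0 := by
    intro B hB q r b n
    by_cases hh : q ≤ r ∧ 0 < n ∧ (r : ℝ) + 1 / n ≤ b ∧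
      (∀ y ∈ B, ∀ t ∈ Icc (q : ℝ) b, (y : RN N) + t • v ∈ Ω)
    · obtain ⟨h1, h2, h3, h4⟩ := hh
      have h1' : (q : ℝ) ≤ r := by exact_mod_cast h1
      filter_upwards [ae_integral_line_eq_zero hv hΩ hu hg h
        (TopologicalSpace.isOpen_of_mem_countableBasis hB) h4 (contDiff_ramp q r n)
        (hasDerivAt_ramp q r n) (continuous_rampDeriv q r n)
        ((tsupport_ramp_subset h1' h2).trans (Icc_subset_Icc_right h3))
        (fun t ht => rampDeriv_eq_zero h1' h2 fun ht' => ht (Icc_subset_Icc_right h3 ht'))]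
        with y hy _ _ _ _ hyB
      exact hy hyB
    · exact Filter.Eventually.of_forall fun y h1 h2 h3 h4 => absurd ⟨h1, h2, h3, h4⟩ hh
  have hbox' := (ae_ball_iff (TopologicalSpace.countable_countableBasis (Perp v))).2
    fun B hB => ae_all_iff.2 fun q => ae_all_iff.2 fun r => ae_all_iff.2 fun b =>
      ae_all_iff.2 fun n => hbox B hB q r b n
  have hslice : ∀ᵐ y : Perp v, LocallyIntegrable (fun t : ℝ => Ω.indicator g (y + t • v)) :=
    (show LocallyIntegrable _ ((volume : Measure (Perp v)).prod volume) from
      locallyIntegrable_comp_lineEquiv hv hg).ae_slice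
  filter_upwards [hbox', hslice, hcont] with y hy hyl hyc
  refine ⟨hyl, fun a b hab hseg => ?_⟩
  rcases hab.eq_or_lt with rfl | hab
  · simp
  have hO : IsOpen (lineEquiv v hv ⁻¹' Ω) := hΩ.preimage (lineEquiv v hv).continuous
  -- A segment inside `Ω` has a product neighbourhood inside `Ω`, and this contains a box of the
  -- countable family.
  obtain ⟨V, W, hV, hW, hyV, hIW, hVW⟩ := generalized_tube_lemma (isCompact_singleton (x := y))
    (isCompact_Icc (a := a) (b := b)) hO (by
      rintro ⟨y', t⟩ ⟨hy', ht⟩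
      rw [mem_singleton_iff] at hy'
      simp only at hy' ht
      subst hy'
      exact hseg t ht)
  obtain ⟨B, hB, hyB, hBV⟩ := (TopologicalSpace.isBasis_countableBasis
      (Perp v)).exists_subset_of_mem_open
    (hyV rfl) hV
  set Φ : ℝ → ℝ := fun s => u (y + s • v) - ∫ t in a..s, Ω.indicator g (y + t • v) with hΦ
  have hint : ∀ s s', IntervalIntegrable (fun t : ℝ => Ω.indicator g (y + t • v)) volume s s' :=
    fun s s' => (hyl.integrableOn_isCompact isCompact_uIcc).intervalIntegrable
  have hΦc : Continuous Φ := hyc.sub (intervalIntegral.continuous_primitive hint a)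
  -- `Φ` is shown to be equal at all rational points of `(a, b)`; continuity then extends this to
  -- the endpoints. The rational `b'` beyond `r` leaves room for the ramp, which reaches `r + 1/n`.
  have hrat : ∀ q r : ℚ, q ≤ r → (q : ℝ) ∈ Ioo a b → (r : ℝ) ∈ Ioo a b → Φ q = Φ r := by
    intro q r hqr hq hr
    have hqr' : (q : ℝ) ≤ r := by exact_mod_cast hqr
    obtain ⟨b', hb'1, hb'2⟩ := exists_rat_btwn hr.2
    have e := sub_eq_integral_of_ramp hyc hyl hqr' (by
      obtain ⟨k, hk⟩ := exists_nat_gt (1 / ((b' : ℝ) - r))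
      filter_upwards [Filter.eventually_ge_atTop k, Filter.eventually_gt_atTop 0] with n hn hn0
      refine hy B hB q r b' n hqr hn0 ?_ ?_ hyB
      · have : (k : ℝ) ≤ n := by exact_mod_cast hn
        have h3 : 0 < (b' : ℝ) - r := by linarith
        have h4 : (0 : ℝ) < n := by exact_mod_cast hn0
        rw [div_lt_iff₀ h3] at hk
        have : 1 / (n : ℝ) ≤ b' - r := by
          rw [div_le_iff₀ h4]
          nlinarith
        linarith
      · intro y' hy' t ht
        exact hVW (show (y', t) ∈ V ×ˢ W from
          ⟨hBV hy', hIW ⟨hq.1.le.trans ht.1, ht.2.trans hb'2.le⟩⟩))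
    have e2 := intervalIntegral.integral_add_adjacent_intervals (hint a q) (hint q r)
    simp only [hΦ]
    linarith
  obtain ⟨q₀, hq₀⟩ := exists_rat_btwn hab
  have hcl : IsClosed {s | Φ s = Φ q₀} := isClosed_eq hΦc continuous_const
  have hsub : Ioo a b ∩ range ((↑) : ℚ → ℝ) ⊆ {s | Φ s = Φ q₀} := by
    rintro _ ⟨hs, q, rfl⟩
    rcases le_total q q₀ with hq | hq
    · exact hrat q q₀ hq hs hq₀
    · exact (hrat q₀ q hq hq₀ hs).symm
  have hsub2 : Icc a b ⊆ {s | Φ s = Φ q₀} := by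
    rw [← closure_Ioo hab.ne]
    refine closure_minimal ?_ hcl
    exact (Rat.denseRange_cast.open_subset_closure_inter isOpen_Ioo).trans
      (closure_minimal hsub hcl)
  have ea : Φ a = Φ q₀ := hsub2 (left_mem_Icc.2 hab.le)
  have eb : Φ b = Φ q₀ := hsub2 (right_mem_Icc.2 hab.le)
  have := eb.trans ea.symm
  simp only [hΦ, intervalIntegral.integral_same] at this
  linarith

/-! ### Sobolev functions on lines: absolute continuity and pointwise derivatives. -/

lemma MeasureTheory.MemLp.locallyIntegrable_indicator {N : ℕ} {p : ℝ≥0∞} (hp : 1 ≤ p)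
    {Ω : Set (RN N)} (hΩ : MeasurableSet Ω) {u : RN N → ℝ} (hu : MemLp u p (volume.restrict Ω)) :
    LocallyIntegrable (Ω.indicator u) :=
  ((memLp_indicator_iff_restrict hΩ).2 hu).locallyIntegrable hp

/-- Singular lines may run in any direction `v`, so the weak partials are combined linearly into a
weak derivative along `v`. -/
lemma MemW.exists_isWeakDirDeriv {N : ℕ} {p : ℝ≥0∞} (hp : 1 ≤ p) {Ω : Set (RN N)} {u : RN N → ℝ}
    (hu : MemW p Ω u) (v : RN N) :
    ∃ g : RN N → ℝ, MemLp g p (volume.restrict Ω) ∧ IsWeakDirDeriv Ω v u g := by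
  choose g hg hw using hu.2
  refine ⟨fun x => ∑ j, v j * g j x, memLp_finsetSum _ fun j _ => (hg j).const_mul _, ?_⟩
  intro φ hφ
  have hui := hu.1.locallyIntegrable hp
  have h1 : ∀ j : Fin N, Integrable (fun x => v j * (u x * fderiv ℝ φ x (unitVec j)))
      (volume.restrict Ω) := fun j =>
    (hui.integrable_mul_of_hasCompactSupport (continuous_fderiv_apply hφ.1 _)
      (hφ.2.1.fderiv_apply' _)).const_mul _
  have h2 : ∀ j : Fin N, Integrable (fun x => v j * (g j x * φ x)) (volume.restrict Ω) := fun j =>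
    (((hg j).locallyIntegrable hp).integrable_mul_of_hasCompactSupport hφ.1.continuous
      hφ.2.1).const_mul _
  have e1 : ∀ x, u x * fderiv ℝ φ x v = ∑ j, v j * (u x * fderiv ℝ φ x (unitVec j)) := by
    intro x
    rw [fderiv_apply_eq_sum, Finset.mul_sum]
    exact Finset.sum_congr rfl fun j _ => by ring
  have e2 : ∀ x, (∑ j, v j * g j x) * φ x = ∑ j, v j * (g j x * φ x) := by
    intro x
    rw [Finset.sum_mul]
    exact Finset.sum_congr rfl fun j _ => by ring
  simp only [e1, e2]
  rw [integral_finsetSum _ fun j _ => h1 j, integral_finsetSum _ fun j _ => h2 j,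
    ← Finset.sum_neg_distrib]
  refine Finset.sum_congr rfl fun j _ => ?_
  rw [integral_const_mul, integral_const_mul, hw j φ hφ]
  ring

lemma absolutelyContinuousOnInterval_of_sub_eq_integral {w γ : ℝ → ℝ} (hγ : LocallyIntegrable γ)
    (h : ∀ t, w t = w 0 + ∫ τ in (0 : ℝ)..t, γ τ) (a b : ℝ) :
    AbsolutelyContinuousOnInterval w a b := by
  have hint : ∀ s s', IntervalIntegrable γ volume s s' :=
    fun s s' => (hγ.integrableOn_isCompact isCompact_uIcc).intervalIntegrable
  have h1 := (hint a b).absolutelyContinuousOnInterval_intervalIntegral (left_mem_uIcc)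
  have h2 : AbsolutelyContinuousOnInterval (fun _ : ℝ => w a) a b :=
    (contDiff_const (n := 1)).contDiffOn.absolutelyContinuousOnInterval
  have h3 : w = (fun _ : ℝ => w a) + fun x => ∫ v in a..x, γ v := by
    ext t
    have := intervalIntegral.integral_add_adjacent_intervals (hint 0 a) (hint a t)
    have e1 := h t
    have e2 := h a
    simp only [Pi.add_apply]
    linarith
  rw [h3]
  exact h2.add h1

/-- The singular summand would be a difference of absolutely continuous functions with derivative
zero almost everywhere, hence constant. -/
lemma AbsolutelyContinuousOnInterval.not_hasSingularPart {w : ℝ → ℝ}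
    (h : ∀ a b, AbsolutelyContinuousOnInterval w a b) : ¬ HasSingularPart w := by
  rintro ⟨g, s, hg, ⟨-, hs, hnc⟩, hw⟩
  have hsac : ∀ a b, AbsolutelyContinuousOnInterval s a b := fun a b => by
    have : s = w - g := by
      ext t
      simp [hw t]
    rw [this]
    exact (h a b).sub (hg a b)
  refine hnc ⟨s 0, fun t => ?_⟩
  obtain ⟨C, hC⟩ := (hsac 0 t).const_of_ae_hasDerivAt_zero
    (hs.mono fun x hx _ => hx)
  rw [hC t right_mem_uIcc, hC 0 left_mem_uIcc]

/-- A Sobolev function that is continuous on lines has no singular part on almost all lines. -/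
lemma MemW.ae_not_hasSingularPart {N : ℕ} {p : ℝ≥0∞} (hp : 1 ≤ p) {u : RN N → ℝ}
    (hu : MemW p univ u) {v : RN N} (hv : v ≠ 0) (hc : ContinuousOnLines v u) :
    ∀ᵐ y : Perp v, ¬ HasSingularPart fun t : ℝ => u (y + t • v) := by
  obtain ⟨g, hg, hw⟩ := hu.exists_isWeakDirDeriv hp v
  filter_upwards [ae_sub_eq_integral hv isOpen_univ
    (hu.1.locallyIntegrable_indicator hp MeasurableSet.univ)
    (hg.locallyIntegrable_indicator hp MeasurableSet.univ) hw hc] with y hy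
  refine AbsolutelyContinuousOnInterval.not_hasSingularPart
    (absolutelyContinuousOnInterval_of_sub_eq_integral hy.1 fun t => ?_)
  rcases le_total 0 t with ht | ht
  · have := hy.2 0 t ht fun _ _ => mem_univ _
    linarith
  · have := hy.2 t 0 ht fun _ _ => mem_univ _
    rw [intervalIntegral.integral_symm] at this
    linarith

lemma MemW.not_singularOnParallelLines {N : ℕ} {p : ℝ≥0∞} (hp : 1 ≤ p) {u : RN N → ℝ}
    (hu : MemW p univ u) (hc : ∀ v : RN N, v ≠ 0 → ContinuousOnLines v u) :
    ¬ SingularOnParallelLines u := by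
  rintro ⟨v, hv, h⟩
  refine h ?_
  have := hu.ae_not_hasSingularPart hp hv (hc v hv)
  rw [ae_iff] at this
  simpa using this

/-- The difference quotient condition is closed in the increment, so for continuous `w` rational
increments suffice. The countable form of the condition is what makes the set of good points null
measurable. -/
lemma hasDerivAt_zero_of_rat {w : ℝ → ℝ} (hw : Continuous w) {d : ℝ}
    (h : ∀ k : ℕ, ∃ m : ℕ, ∀ q : ℚ, |(q : ℝ)| < 1 / (m + 1) →
      |w q - w 0 - q * d| ≤ 1 / (k + 1) * |(q : ℝ)|) : HasDerivAt w d 0 := by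
  rw [hasDerivAt_iff_isLittleO, Asymptotics.isLittleO_iff]
  intro c hc
  obtain ⟨k, hk⟩ := exists_nat_one_div_lt hc
  obtain ⟨m, hm⟩ := h k
  have hm0 : (0 : ℝ) < 1 / (m + 1) := by positivity
  have hcl : IsClosed {t : ℝ | |w t - w 0 - t * d| ≤ 1 / (k + 1) * |t|} :=
    isClosed_le (by fun_prop) (by fun_prop)
  have hsub : Ioo (-(1 / ((m : ℝ) + 1))) (1 / (m + 1)) ⊆
      {t : ℝ | |w t - w 0 - t * d| ≤ 1 / (k + 1) * |t|} := by
    refine (Rat.denseRange_cast.open_subset_closure_inter isOpen_Ioo).trans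
      (closure_minimal ?_ hcl)
    rintro _ ⟨ht, q, rfl⟩
    exact hm q (abs_lt.2 ht)
  filter_upwards [Ioo_mem_nhds (neg_lt_zero.2 hm0) hm0] with t ht
  have := hsub ht
  simp only [mem_ofPred_eq] at this
  rw [sub_zero, smul_eq_mul, Real.norm_eq_abs, Real.norm_eq_abs]
  exact this.trans (by gcongr)

lemma HasDerivAt.exists_rat {w : ℝ → ℝ} {d : ℝ} (h : HasDerivAt w d 0) (k : ℕ) :
    ∃ m : ℕ, ∀ q : ℚ, |(q : ℝ)| < 1 / (m + 1) →
      |w q - w 0 - q * d| ≤ 1 / (k + 1) * |(q : ℝ)| := by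
  rw [hasDerivAt_iff_isLittleO, Asymptotics.isLittleO_iff] at h
  have := h (c := 1 / ((k : ℝ) + 1)) (by positivity)
  rw [Metric.eventually_nhds_iff] at this
  obtain ⟨ε, hε, hh⟩ := this
  obtain ⟨m, hm⟩ := exists_nat_one_div_lt hε
  refine ⟨m, fun q hq => ?_⟩
  have := hh (y := q) (by rw [Real.dist_eq, sub_zero]; exact hq.trans hm)
  simpa only [sub_zero, smul_eq_mul, Real.norm_eq_abs] using this

lemma nullMeasurableSet_rat_deriv {N : ℕ} (v : RN N) {u g : RN N → ℝ} (hu : AEMeasurable u)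
    (hg : AEMeasurable g) :
    NullMeasurableSet {x : RN N | ∀ k : ℕ, ∃ m : ℕ, ∀ q : ℚ, |(q : ℝ)| < 1 / (m + 1) →
      |u (x + (q : ℝ) • v) - u x - q * g x| ≤ 1 / (k + 1) * |(q : ℝ)|} := by
  have h1 : ∀ (k m : ℕ) (q : ℚ), NullMeasurableSet {x : RN N | |(q : ℝ)| < 1 / (m + 1) →
      |u (x + (q : ℝ) • v) - u x - q * g x| ≤ 1 / (k + 1) * |(q : ℝ)|} := by
    intro k m q
    by_cases hq : |(q : ℝ)| < 1 / (m + 1)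
    · simp only [hq, true_imp_iff]
      refine nullMeasurableSet_le ?_ aemeasurable_const
      have h2 : AEMeasurable fun x => u (x + (q : ℝ) • v) :=
        hu.comp_quasiMeasurePreserving (quasiMeasurePreserving_add_right volume ((q : ℝ) • v))
      exact continuous_abs.measurable.comp_aemeasurable ((h2.sub hu).sub (hg.const_mul _))
    · simp only [hq, false_imp_iff]
      exact nullMeasurableSet_univ
  have e : {x : RN N | ∀ k : ℕ, ∃ m : ℕ, ∀ q : ℚ, |(q : ℝ)| < 1 / (m + 1) →
      |u (x + (q : ℝ) • v) - u x - q * g x| ≤ 1 / (k + 1) * |(q : ℝ)|} =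
      ⋂ k : ℕ, ⋃ m : ℕ, ⋂ q : ℚ, {x : RN N | |(q : ℝ)| < 1 / (m + 1) →
      |u (x + (q : ℝ) • v) - u x - q * g x| ≤ 1 / (k + 1) * |(q : ℝ)|} := by
    ext x
    simp
  rw [e]
  exact NullMeasurableSet.iInter fun k => NullMeasurableSet.iUnion fun m =>
    NullMeasurableSet.iInter fun q => h1 k m q

/-- Almost everywhere on the open set `Ω`, a function that is continuous on lines has its weak
derivative in the direction `v` as pointwise derivative. -/
lemma ae_hasLineDerivAt {N : ℕ} {v : RN N} (hv : v ≠ 0) {Ω : Set (RN N)} (hΩ : IsOpen Ω)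
    {u g : RN N → ℝ} (hum : AEMeasurable u) (hu : LocallyIntegrable (Ω.indicator u))
    (hg : LocallyIntegrable (Ω.indicator g))
    (h : IsWeakDirDeriv Ω v u g) (hcont : ContinuousOnLines v u) :
    ∀ᵐ x, x ∈ Ω → HasLineDerivAt ℝ u (g x) x v := by
  set s : Set (RN N) := {x : RN N | ∀ k : ℕ, ∃ m : ℕ, ∀ q : ℚ, |(q : ℝ)| < 1 / (m + 1) →
      |u (x + (q : ℝ) • v) - u x - q * Ω.indicator g x| ≤ 1 / (k + 1) * |(q : ℝ)|} with hs
  have hsm : NullMeasurableSet (s ∪ Ωᶜ) :=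
    (nullMeasurableSet_rat_deriv v hum hg.aestronglyMeasurable.aemeasurable).union
      hΩ.measurableSet.compl.nullMeasurableSet
  have h1 : ∀ᵐ x, x ∈ s ∪ Ωᶜ := by
    refine ae_of_ae_line hv hsm ?_
    filter_upwards [ae_sub_eq_integral hv hΩ hu hg h hcont] with y hy
    filter_upwards [LocallyIntegrable.ae_hasDerivAt_integral hy.1] with t ht
    by_cases hΩt : (y : RN N) + t • v ∈ Ω
    · refine Or.inl fun k => ?_
      have hO : IsOpen ((fun τ : ℝ => (y : RN N) + τ • v) ⁻¹' Ω) := hΩ.preimage (by fun_prop)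
      obtain ⟨ε, hε, hball⟩ := Metric.isOpen_iff.1 hO t hΩt
      -- The base point `t - ε / 2` lies to the left of `t`, so the integral formula is available on
      -- both sides of `t`.
      have h2 : HasDerivAt (fun τ : ℝ => u (y + τ • v)) (Ω.indicator g (y + t • v)) t := by
        have h3 := (ht (t - ε / 2)).const_add (u (y + (t - ε / 2) • v))
        refine h3.congr_of_eventuallyEq ?_
        filter_upwards [Ioo_mem_nhds (show t - ε / 2 < t by linarith)
          (show t < t + ε / 2 by linarith)] with τ hτ
        have := hy.2 (t - ε / 2) τ hτ.1.le fun σ hσ => hball (by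
          rw [Metric.mem_ball, Real.dist_eq, abs_lt]
          constructor <;> linarith [hσ.1, hσ.2, hτ.2])
        linarith
      have h4 : HasDerivAt (fun τ : ℝ => u ((y + t • v) + τ • v))
          (Ω.indicator g (y + t • v)) 0 := by
        have h5 : HasDerivAt (fun τ : ℝ => t + τ) 1 0 := (hasDerivAt_id (0 : ℝ)).const_add t
        have h6 := HasDerivAt.comp (h₂ := fun τ : ℝ => u (y + τ • v)) (h := fun τ : ℝ => t + τ)
          (0 : ℝ) (by simpa using h2) h5
        rw [mul_one] at h6
        refine h6.congr_of_eventuallyEq (Filter.Eventually.of_forall fun τ => ?_)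
        simp [add_smul, add_assoc]
      simpa using h4.exists_rat k
    · exact Or.inr hΩt
  -- The rational condition gives a derivative only where `u` is continuous along the line through
  -- `x`; this passes from almost every `y` to almost every `x`.
  have h2 : ∀ᵐ x : RN N, Continuous fun t : ℝ => u (x + t • v) := by
    rw [← ae_lineEquiv_iff v hv]
    have : ∀ᵐ z : Perp v × ℝ, Continuous fun t : ℝ => u (z.1 + t • v) :=
      Measure.quasiMeasurePreserving_fst.ae hcont
    filter_upwards [this] with z hz
    refine (hz.comp (continuous_const_add z.2)).congr fun t => ?_
    simp [add_smul, add_assoc]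
  filter_upwards [h1, h2] with x hx1 hx2 hxΩ
  rcases hx1 with hx1 | hx1
  · rw [hs, mem_ofPred_eq, indicator_of_mem hxΩ] at hx1
    exact hasDerivAt_zero_of_rat hx2 (by simpa using hx1)
  · exact absurd hxΩ hx1

lemma MemW.mono_univ {N : ℕ} {p : ℝ≥0∞} {Ω : Set (RN N)} {u : RN N → ℝ}
    (hu : MemW p univ u) : MemW p Ω u := by
  obtain ⟨h1, h2⟩ := hu
  rw [Measure.restrict_univ] at h1
  refine ⟨h1.restrict Ω, fun j => ?_⟩
  obtain ⟨g, hg, hw⟩ := h2 j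
  rw [Measure.restrict_univ] at hg
  refine ⟨g, hg.restrict Ω, fun φ hφ => ?_⟩
  have h3 := hw φ ⟨hφ.1, hφ.2.1, subset_univ _⟩
  simp only [Measure.restrict_univ] at h3
  have h0 : ∀ x, x ∉ Ω → φ x = 0 := fun x hx =>
    image_eq_zero_of_notMem_tsupport fun h => hx (hφ.2.2 h)
  have h0' : ∀ x, x ∉ Ω → fderiv ℝ φ x (unitVec j) = 0 := fun x hx => by
    rw [image_eq_zero_of_notMem_tsupport (f := fderiv ℝ φ)
      fun h => hx (hφ.2.2 (tsupport_fderiv_subset ℝ h))]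
    simp
  rw [setIntegral_eq_integral_of_forall_compl_eq_zero fun x hx => by rw [h0' x hx, mul_zero],
    setIntegral_eq_integral_of_forall_compl_eq_zero fun x hx => by rw [h0 x hx, mul_zero], h3]

/-! ### From pointwise to weak derivatives when there is no singular part. -/

/-- Subtracting the primitive of `γ` leaves a continuous function with derivative zero almost
everywhere. If it were not constant, it would be a singular part of `w`. -/
lemma eq_add_integral_of_not_hasSingularPart {w γ : ℝ → ℝ} (hw : Continuous w)
    (hγ : LocallyIntegrable γ) (hd : ∀ᵐ t, HasDerivAt w (γ t) t) (hs : ¬ HasSingularPart w)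
    (t : ℝ) : w t = w 0 + ∫ τ in (0 : ℝ)..t, γ τ := by
  set P : ℝ → ℝ := fun t => ∫ τ in (0 : ℝ)..t, γ τ with hP
  have hint : ∀ s s', IntervalIntegrable γ volume s s' :=
    fun s s' => (hγ.integrableOn_isCompact isCompact_uIcc).intervalIntegrable
  have hPac : ∀ a b, AbsolutelyContinuousOnInterval P a b :=
    absolutelyContinuousOnInterval_of_sub_eq_integral hγ fun t => by simp [hP]
  by_contra hne
  refine hs ⟨P, fun t => w t - P t, hPac, ⟨?_, ?_, ?_⟩, fun t => by simp⟩
  · exact hw.sub (intervalIntegral.continuous_primitive hint 0)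
  · filter_upwards [hd, LocallyIntegrable.ae_hasDerivAt_integral hγ] with t h1 h2
    have h3 := h1.sub (h2 0)
    rw [sub_self] at h3
    exact h3
  · rintro ⟨c, hc⟩
    refine hne ?_
    have h1 := hc t
    have h2 := hc 0
    simp only [hP, intervalIntegral.integral_same] at h1 h2
    linarith

/-- Integration by parts for absolutely continuous functions, on an interval whose endpoints lie
outside the support of `ψ`. -/
lemma integral_mul_deriv_eq_neg {w γ ψ ψ' : ℝ → ℝ} (hγ : LocallyIntegrable γ)
    (hw : ∀ t, w t = w 0 + ∫ τ in (0 : ℝ)..t, γ τ) (hψ : ∀ t, HasDerivAt ψ (ψ' t) t)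
    (hψ' : Continuous ψ') (hc : HasCompactSupport ψ) :
    ∫ t, (w t * ψ' t + γ t * ψ t) = 0 := by
  obtain ⟨R, hR⟩ := hc.isBounded.subset_closedBall 0
  have h0 : ∀ t, t ∉ Icc (-R) R → ψ t = 0 := fun t ht =>
    image_eq_zero_of_notMem_tsupport fun h => ht (by
      have := hR h
      rwa [Real.closedBall_eq_Icc, zero_sub, zero_add] at this)
  have h0' : ∀ t, t ∉ Icc (-R) R → ψ' t = 0 := fun t ht => by
    rw [← (hψ t).deriv]
    have : ψ =ᶠ[nhds t] fun _ => 0 := by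
      filter_upwards [isClosed_Icc.isOpen_compl.mem_nhds ht] with s hs
      exact h0 s hs
    rw [this.deriv_eq, deriv_const]
  set a : ℝ := -R - 1
  set b : ℝ := |R| + 1
  have hb : b ∉ Icc (-R) R := fun h => by
    have := le_abs_self R
    linarith [h.2]
  have ha : a ∉ Icc (-R) R := fun h => by
    linarith [h.1]
  have hwc : ∀ a b, AbsolutelyContinuousOnInterval w a b :=
    absolutelyContinuousOnInterval_of_sub_eq_integral hγ hw
  have hψc : ContDiff ℝ 1 ψ := by
    rw [contDiff_one_iff_deriv]
    refine ⟨fun t => (hψ t).differentiableAt, ?_⟩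
    have : deriv ψ = ψ' := funext fun t => (hψ t).deriv
    rwa [this]
  have h1 := (hwc a b).integral_mul_deriv_eq_deriv_mul
    (hψc.contDiffOn.absolutelyContinuousOnInterval)
  rw [h0 a ha, h0 b hb, mul_zero, mul_zero, sub_zero, zero_sub] at h1
  have h2 : ∫ t in a..b, deriv w t * ψ t = ∫ t in a..b, γ t * ψ t := by
    refine intervalIntegral.integral_congr_ae ?_
    filter_upwards [LocallyIntegrable.ae_hasDerivAt_integral hγ] with t ht _
    have h3 : HasDerivAt w (γ t) t :=
      ((ht 0).const_add (w 0)).congr_of_eventuallyEq (Filter.Eventually.of_forall hw)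
    rw [h3.deriv]
  have h3 : ∫ t in a..b, w t * deriv ψ t = ∫ t in a..b, w t * ψ' t := by
    congr 1
    ext t
    rw [(hψ t).deriv]
  rw [h2, h3] at h1
  have hwcont : Continuous w := by
    have : w = fun t => w 0 + ∫ τ in (0 : ℝ)..t, γ τ := funext hw
    rw [this]
    exact continuous_const.add (intervalIntegral.continuous_primitive
      (fun s s' => (hγ.integrableOn_isCompact isCompact_uIcc).intervalIntegrable) 0)
  have i1 : IntervalIntegrable (fun t => w t * ψ' t) volume a b :=
    (hwcont.mul hψ').intervalIntegrable _ _
  have i2 : IntervalIntegrable (fun t => γ t * ψ t) volume a b :=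
    ((hγ.integrableOn_isCompact isCompact_uIcc).intervalIntegrable).mul_continuousOn
      hψc.continuous.continuousOn
  rw [← intervalIntegral.integral_eq_integral_of_support_subset (a := a) (b := b),
    intervalIntegral.integral_add i1 i2, h1]
  · ring
  · intro t ht
    by_contra hmem
    have : t ∉ Icc (-R) R := fun h => hmem
      ⟨by linarith [h.1], by have := le_abs_self R; linarith [h.2]⟩
    exact ht (by simp [h0 t this, h0' t this])

/-- If almost no line in the direction `v` carries a singular part, then the pointwise derivative
in the direction `v` is a weak derivative. -/
lemma isWeakDirDeriv_of_ae_not_hasSingularPart {N : ℕ} {v : RN N} (hv : v ≠ 0) {u d : RN N → ℝ}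
    (hu : LocallyIntegrable u) (hd : LocallyIntegrable d)
    (h : ∀ᵐ x, HasLineDerivAt ℝ u (d x) x v) (hc : ContinuousOnLines v u)
    (hs : ∀ᵐ y : Perp v, ¬ HasSingularPart fun t : ℝ => u (y + t • v)) :
    IsWeakDirDeriv univ v u d := by
  intro φ hφ
  simp only [Measure.restrict_univ]
  have i1 : Integrable fun x => u x * fderiv ℝ φ x v :=
    hu.integrable_mul_of_hasCompactSupport (continuous_fderiv_apply hφ.1 v)
      (hφ.2.1.fderiv_apply' v)
  have i2 : Integrable fun x => d x * φ x :=
    hd.integrable_mul_of_hasCompactSupport hφ.1.continuous hφ.2.1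
  rw [← add_eq_zero_iff_eq_neg, ← integral_add i1 i2]
  obtain ⟨c, hc0, hint⟩ := integral_lineEquiv v hv
  have e := hint fun x => u x * fderiv ℝ φ x v + d x * φ x
  refine (mul_eq_zero.1 (e.symm.trans ?_)).resolve_left hc0
  have i3 := (integrable_lineEquiv_iff v hv).2 (i1.add i2)
  rw [Measure.volume_eq_prod] at i3 ⊢
  have e2 := integral_prod _ i3
  simp only [Pi.add_apply] at e2
  rw [e2]
  refine integral_eq_zero_of_ae ?_
  have hslice : ∀ᵐ y : Perp v, LocallyIntegrable (fun t : ℝ => d (y + t • v)) :=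
    (show LocallyIntegrable _ ((volume : Measure (Perp v)).prod volume) from
      locallyIntegrable_comp_lineEquiv hv hd).ae_slice
  filter_upwards [ae_line hv h, hc, hs, hslice] with y h1 h2 h3 h4
  have h5 : ∀ᵐ t, HasDerivAt (fun t : ℝ => u (y + t • v)) (d (y + t • v)) t := by
    filter_upwards [h1] with t ht
    have e3 : HasDerivAt (fun τ : ℝ => τ - t) 1 t := (hasDerivAt_id t).sub_const t
    have e4 := HasDerivAt.comp (h₂ := fun τ : ℝ => u (y + t • v + τ • v)) (h := fun τ : ℝ => τ - t)
      t (by rw [sub_self]; exact ht) e3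
    rw [mul_one] at e4
    refine e4.congr_of_eventuallyEq (Filter.Eventually.of_forall fun τ => ?_)
    simp only [Function.comp, sub_smul, add_assoc, add_sub_cancel]
  refine integral_mul_deriv_eq_neg h4
    (eq_add_integral_of_not_hasSingularPart h2 h4 h5 h3)
    (fun t => hasDerivAt_line hφ.1 y v t) ((continuous_fderiv_apply hφ.1 v).comp (by fun_prop)) ?_
  refine HasCompactSupport.intro (K := Prod.snd '' ((lineEquiv v hv).symm '' tsupport φ))
    ((hφ.2.1.isCompact.image (lineEquiv v hv).symm.continuous).image continuous_snd) fun t ht => ?_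
  refine image_eq_zero_of_notMem_tsupport fun hmem => ht ?_
  exact ⟨(y, t), ⟨y + t • v, hmem, (lineEquiv v hv).symm_apply_apply (y, t)⟩, rfl⟩

lemma unitVec_ne_zero {N : ℕ} (j : Fin N) : (unitVec j : RN N) ≠ 0 := by
  simp

/-- A function in `V^{1,p}` that is continuous on lines and does not belong to `W^{1,p}` is
singular on a set of parallel lines. -/
lemma MemV.singularOnParallelLines {N : ℕ} {p : ℝ≥0∞} (hp : 1 ≤ p) {u : RN N → ℝ}
    (hu : MemV p u) (hc : ∀ v : RN N, v ≠ 0 → ContinuousOnLines v u) (hw : ¬ MemW p univ u) :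
    SingularOnParallelLines u := by
  by_contra hns
  refine hw ⟨hu.1.restrict _, fun j => ⟨fun x => lineDeriv ℝ u x (unitVec j),
    (hu.2 j).2.restrict _, ?_⟩⟩
  refine isWeakDirDeriv_of_ae_not_hasSingularPart (unitVec_ne_zero j)
    (hu.1.locallyIntegrable hp) ((hu.2 j).2.locallyIntegrable hp)
    ((hu.2 j).1.mono fun x hx => hx.hasLineDerivAt) (hc _ (unitVec_ne_zero j)) ?_
  rw [ae_iff]
  by_contra h0
  exact hns ⟨_, unitVec_ne_zero j, by simpa using h0⟩

/-- Let `u` be in `W^{1,p}` off `K`, and continuous on lines. If `u` has pointwise partial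
derivatives almost everywhere on `K`, and they are in `L^p(K)`, then `u` is in `V^{1,p}`. -/
lemma MemW.memV {N : ℕ} {p : ℝ≥0∞} (hp : 1 ≤ p) {K : Set (RN N)} (hK : IsCompact K)
    {u : RN N → ℝ} (hu : MemW p Kᶜ u) (huL : MemLp u p volume)
    (hc : ∀ v : RN N, v ≠ 0 → ContinuousOnLines v u)
    (hd : ∀ j : Fin N, ∃ d : RN N → ℝ, MemLp d p (volume.restrict K) ∧
      ∀ᵐ x, x ∈ K → HasLineDerivAt ℝ u (d x) x (unitVec j)) :
    MemV p u := by
  refine ⟨huL, fun j => ?_⟩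
  obtain ⟨d, hdL, hd⟩ := hd j
  obtain ⟨g, hgL, hg⟩ := hu.2 j
  have hm := hK.measurableSet
  have h1 := ae_hasLineDerivAt (unitVec_ne_zero j) hK.isClosed.isOpen_compl
    huL.aestronglyMeasurable.aemeasurable
    (hu.1.locallyIntegrable_indicator hp hm.compl) (hgL.locallyIntegrable_indicator hp hm.compl)
    hg (hc _ (unitVec_ne_zero j))
  have h2 : ∀ᵐ x, HasLineDerivAt ℝ u (K.indicator d x + Kᶜ.indicator g x) x (unitVec j) := by
    filter_upwards [h1, hd] with x hx1 hx2
    by_cases hx : x ∈ K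
    · simpa [hx] using hx2 hx
    · simpa [hx] using hx1 hx
  refine ⟨h2.mono fun x hx => hx.lineDifferentiableAt, ?_⟩
  have h3 : MemLp (fun x => K.indicator d x + Kᶜ.indicator g x) p volume :=
    ((memLp_indicator_iff_restrict hm).2 hdL).add ((memLp_indicator_iff_restrict hm.compl).2 hgL)
  exact h3.ae_eq (h2.mono fun x hx => hx.lineDeriv.symm)

/-! ### Approximating a covector field by gradients of small functions. -/

/-- A function supported in a ball that is affine on a large concentric ball, with a gradient bound
that does not depend on the radius. -/
lemma exists_cell {N : ℕ} {δ : ℝ} (hδ : 0 < δ) (hδ1 : δ < 1) :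
    ∃ A : ℝ, 0 < A ∧ ∀ (L : RN N →L[ℝ] ℝ) (c : RN N) (r : ℝ), 0 < r →
      ∃ g : RN N → ℝ, ContDiff ℝ (⊤ : ℕ∞) g ∧ tsupport g ⊆ Metric.closedBall c r ∧
        (∀ x, |g x| ≤ ‖L‖ * r) ∧ (∀ x, ‖fderiv ℝ g x‖ ≤ A * ‖L‖) ∧
        ∀ x ∈ Metric.closedBall c ((1 - δ) * r), fderiv ℝ g x = L := by
  -- The inner radius exceeds `1 - δ`, so after scaling the bump is 1 in a neighbourhood of the
  -- closed ball where the gradient must equal `L`.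
  let b : ContDiffBump (0 : RN N) := ⟨1 - δ / 2, 1, by linarith, by linarith⟩
  have hb : ContDiff ℝ (⊤ : ℕ∞) b := b.contDiff
  obtain ⟨B, hB⟩ := (hb.continuous_fderiv (by simp)).bounded_above_of_compact_support
    (b.hasCompactSupport.fderiv ℝ)
  have hB0 : 0 ≤ B := (norm_nonneg _).trans (hB 0)
  refine ⟨1 + B, by positivity, fun L c r hr => ?_⟩
  set g : RN N → ℝ := fun x => L (x - c) * b (r⁻¹ • (x - c)) with hg
  have hsm : ContDiff ℝ (⊤ : ℕ∞) g :=
    (L.contDiff.comp (contDiff_id.sub contDiff_const)).mul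
      (hb.comp ((contDiff_id.sub contDiff_const).const_smul _))
  have hzero : ∀ x, x ∉ Metric.closedBall c r → g x = 0 := by
    intro x hx
    rw [Metric.mem_closedBall, not_le, dist_eq_norm] at hx
    have : b (r⁻¹ • (x - c)) = 0 := b.zero_of_le_dist (by
      rw [dist_zero_right, norm_smul, norm_inv, Real.norm_of_nonneg hr.le]
      change 1 ≤ r⁻¹ * ‖x - c‖
      rw [inv_mul_eq_div, one_le_div hr]
      exact hx.le)
    simp [hg, this]
  have hts : tsupport g ⊆ Metric.closedBall c r :=
    closure_minimal (fun x hx => by_contra fun h => hx (hzero x h)) Metric.isClosed_closedBall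
  have hbnd : ∀ x, x ∈ Metric.closedBall c r → |L (x - c)| ≤ ‖L‖ * r := fun x hx => by
    rw [Metric.mem_closedBall, dist_eq_norm] at hx
    exact (L.le_opNorm _).trans (by gcongr)
  have hder : ∀ x, HasFDerivAt g (L (x - c) • (r⁻¹ • fderiv ℝ b (r⁻¹ • (x - c)))
      + b (r⁻¹ • (x - c)) • L) x := by
    intro x
    have h1 : HasFDerivAt (fun x => L (x - c)) L x :=
      L.hasFDerivAt.comp x ((hasFDerivAt_id x).sub_const c)
    have h2 : HasFDerivAt (fun x : RN N => r⁻¹ • (x - c)) (r⁻¹ • ContinuousLinearMap.id ℝ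
        (RN N)) x :=
      ((hasFDerivAt_id x).sub_const c).const_smul r⁻¹
    have h3 : HasFDerivAt (fun x => b (r⁻¹ • (x - c)))
        ((fderiv ℝ b (r⁻¹ • (x - c))).comp (r⁻¹ • ContinuousLinearMap.id ℝ (RN N))) x :=
      (hb.differentiable (by simp) _).hasFDerivAt.comp x h2
    exact (h1.mul h3).congr_fderiv (by ext y; simp)
  refine ⟨g, hsm, hts, fun x => ?_, fun x => ?_, fun x hx => ?_⟩
  · by_cases hx : x ∈ Metric.closedBall c r
    · rw [hg, abs_mul, abs_of_nonneg b.nonneg]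
      exact (mul_le_of_le_one_right (abs_nonneg _) b.le_one).trans (hbnd x hx)
    · rw [hzero x hx, abs_zero]
      positivity
  · by_cases hx : x ∈ Metric.closedBall c r
    · rw [(hder x).fderiv]
      refine (norm_add_le _ _).trans ?_
      rw [norm_smul, norm_smul, norm_smul, norm_inv, Real.norm_of_nonneg hr.le,
        Real.norm_of_nonneg (b.nonneg (x := r⁻¹ • (x - c))), Real.norm_eq_abs]
      -- The factor `r⁻¹` from rescaling the bump cancels against `|L (x - c)| ≤ ‖L‖ r`, which makes
      -- the constant independent of `r`.
      have h1 : |L (x - c)| * (r⁻¹ * ‖fderiv ℝ b (r⁻¹ • (x - c))‖) ≤ ‖L‖ * r * (r⁻¹ * B) := by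
        gcongr
        · exact hbnd x hx
        · exact hB _
      have h2 : ‖L‖ * r * (r⁻¹ * B) = B * ‖L‖ := by
        field_simp
      have h3 : b (r⁻¹ • (x - c)) * ‖L‖ ≤ 1 * ‖L‖ := by
        gcongr
        exact b.le_one
      linarith
    · rw [image_eq_zero_of_notMem_tsupport (f := fderiv ℝ g)
        fun h => hx (hts (tsupport_fderiv_subset ℝ h)), norm_zero]
      positivity
  · have hlt : (1 - δ) * r < (1 - δ / 2) * r := by nlinarith
    have hx' : x ∈ Metric.ball c ((1 - δ / 2) * r) :=
      Metric.closedBall_subset_ball hlt hx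
    have : g =ᶠ[nhds x] fun x => L (x - c) := by
      filter_upwards [Metric.isOpen_ball.mem_nhds hx'] with y hy
      have : b (r⁻¹ • (y - c)) = 1 := b.one_of_mem_closedBall (by
        rw [Metric.mem_ball, dist_eq_norm] at hy
        rw [mem_closedBall_zero_iff, norm_smul, norm_inv, Real.norm_of_nonneg hr.le, inv_mul_eq_div,
          div_le_iff₀ hr]
        exact hy.le)
      simp [hg, this]
    rw [this.fderiv_eq]
    exact (L.hasFDerivAt.comp x ((hasFDerivAt_id x).sub_const c)).fderiv

/-- Up to small measure, a compact set is filled by finitely many small disjoint closed balls in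
which its complement has small proportion. -/
lemma exists_finite_balls {N : ℕ} {K : Set (RN N)} (hK : IsCompact K) {κ η : ℝ≥0∞} (hκ : 0 < κ)
    (hη : 0 < η) {ρ : ℝ} (hρ : 0 < ρ) (hρ1 : ρ ≤ 1) :
    ∃ (s : Finset (RN N)) (r : RN N → ℝ), (∀ c ∈ s, c ∈ K ∧ 0 < r c ∧ r c ≤ ρ) ∧
      (s : Set (RN N)).PairwiseDisjoint (fun c => Metric.closedBall c (r c)) ∧
      volume (K \ ⋃ c ∈ s, Metric.closedBall c (r c)) ≤ η ∧
      (∑ c ∈ s, volume (Metric.closedBall c (r c))) ≤ volume (Metric.cthickening 1 K) ∧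
      volume (Kᶜ ∩ ⋃ c ∈ s, Metric.closedBall c (r c)) ≤ κ * volume (Metric.cthickening 1 K) := by
  have hm := hK.measurableSet
  set D : RN N → Set ℝ := fun x =>
    {r | volume (Kᶜ ∩ Metric.closedBall x r) ≤ κ * volume (Metric.closedBall x r)} with hD
  set K' : Set (RN N) := {x ∈ K | ∀ δ > 0, (D x ∩ Ioo 0 δ).Nonempty} with hK'
  have hnull : volume (K \ K') = 0 := by
    -- Almost every point of `K` is a density point, so `Kᶜ` fills a proportion at most `κ` of
    -- arbitrarily small balls around it.
    have h1 := Besicovitch.ae_tendsto_measure_inter_div_of_measurableSet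
      (volume : Measure (RN N)) hm.compl
    rw [← nonpos_iff_eq_zero]
    rw [ae_iff] at h1
    rw [← h1]
    refine measure_mono fun x hx hcon => hx.2 ⟨hx.1, fun δ hδ => ?_⟩
    rw [indicator_of_notMem (by simpa using hx.1)] at hcon
    have h2 := (hcon.eventually (ge_mem_nhds hκ)).and (Ioo_mem_nhdsGT hδ)
    obtain ⟨r, hr1, hr2⟩ := h2.exists
    refine ⟨r, ?_, hr2⟩
    rw [hD, mem_ofPred_eq]
    rwa [ENNReal.div_le_iff (Metric.measure_closedBall_pos _ _ hr2.1).ne'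
      measure_closedBall_lt_top.ne] at hr1
  obtain ⟨t, r, htc, htK, hr, hcov, hdisj⟩ := Besicovitch.exists_disjoint_closedBall_covering_ae
    (volume : Measure (RN N)) D K' (fun x hx => hx.2) (fun _ => ρ) fun _ _ => hρ
  have hsub : ∀ c ∈ t, Metric.closedBall c (r c) ⊆ Metric.cthickening 1 K := fun c hc => by
    refine (Metric.closedBall_subset_closedBall ((hr c hc).2.2.le.trans hρ1)).trans ?_
    exact Metric.closedBall_subset_cthickening (htK hc).1 1
  have hV : volume (Metric.cthickening 1 K) ≠ ∞ := hK.cthickening.measure_ne_top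
  have : Countable t := htc
  have hsum : ∑' i : t, volume (Metric.closedBall (i : RN N) (r i)) ≤
      volume (Metric.cthickening 1 K) := by
    rw [← measure_biUnion htc hdisj fun c _ => Metric.isClosed_closedBall.measurableSet]
    exact measure_mono (iUnion₂_subset hsub)
  -- The disjoint balls have finite total measure, so all but finitely many can be discarded at cost
  -- `η`.
  have htail := ENNReal.tendsto_tsum_compl_atTop_zero (ne_top_of_le_ne_top hV hsum)
  obtain ⟨S, hS⟩ := (htail.eventually (ge_mem_nhds hη)).exists
  classical
  set s : Finset (RN N) := S.map (Function.Embedding.subtype _) with hs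
  have hst : ∀ c ∈ s, c ∈ t := fun c hc => by
    obtain ⟨i, -, rfl⟩ := Finset.mem_map.1 hc
    exact i.2
  have hsumS : (∑ c ∈ s, volume (Metric.closedBall c (r c))) ≤ volume (Metric.cthickening 1 K) := by
    rw [hs, Finset.sum_map]
    exact (ENNReal.sum_le_tsum S).trans hsum
  refine ⟨s, r, fun c hc => ⟨(htK (hst c hc)).1, (hr c (hst c hc)).2.1, (hr c (hst c hc)).2.2.le⟩,
    hdisj.subset hst, ?_, hsumS, ?_⟩
  · have h1 : K \ ⋃ c ∈ s, Metric.closedBall c (r c) ⊆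
        ((K \ K') ∪ (K' \ ⋃ c ∈ t, Metric.closedBall c (r c))) ∪
          ⋃ i : {i : t // i ∉ S}, Metric.closedBall ((i : t) : RN N) (r i) := by
      intro x hx
      by_cases h2 : x ∈ K'
      · by_cases h3 : x ∈ ⋃ c ∈ t, Metric.closedBall c (r c)
        · obtain ⟨c, hc, hxc⟩ := mem_iUnion₂.1 h3
          refine Or.inr (mem_iUnion.2 ⟨⟨⟨c, hc⟩, fun hmem => hx.2 (mem_iUnion₂.2 ⟨c, ?_,
              hxc⟩)⟩, hxc⟩)
          exact Finset.mem_map.2 ⟨⟨c, hc⟩, hmem, rfl⟩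
        · exact Or.inl (Or.inr ⟨h2, h3⟩)
      · exact Or.inl (Or.inl ⟨hx.1, h2⟩)
    refine (measure_mono h1).trans ((measure_union_le _ _).trans ?_)
    rw [measure_union_null hnull hcov, zero_add]
    exact (measure_iUnion_le _).trans hS
  · rw [inter_iUnion₂]
    refine (measure_biUnion_finset_le _ _).trans ?_
    refine le_trans (Finset.sum_le_sum fun c hc => (hr c (hst c hc)).1) ?_
    rw [← Finset.mul_sum]
    gcongr

/-- The factor is the proportion of a ball outside the concentric ball of ratio `1 - δ`, and it
tends to 0 with `δ`. -/
lemma exists_measure_shell_le {N : ℕ} {V η : ℝ≥0∞} (hV : V ≠ ∞) (hη : 0 < η) :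
    ∃ δ : ℝ, 0 < δ ∧ δ < 1 ∧ ENNReal.ofReal (1 - (1 - δ) ^ N) * V ≤ η := by
  have h1 : Filter.Tendsto (fun δ : ℝ => ENNReal.ofReal (1 - (1 - δ) ^ N) * V) (nhds 0)
      (nhds (ENNReal.ofReal (1 - (1 - 0) ^ N) * V)) := by
    refine ENNReal.Tendsto.mul_const (ENNReal.tendsto_ofReal ?_) (Or.inr hV)
    exact (Continuous.tendsto (by fun_prop) (0 : ℝ))
  simp only [sub_zero, one_pow, sub_self, ENNReal.ofReal_zero, zero_mul] at h1
  have h2 := ((h1.mono_left nhdsWithin_le_nhds).eventually (ge_mem_nhds hη)).and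
    (Ioo_mem_nhdsGT (zero_lt_one (α := ℝ)))
  obtain ⟨δ, hδ, hδ'⟩ := h2.exists
  exact ⟨δ, hδ'.1, hδ'.2, hδ⟩

lemma volume_shell {N : ℕ} (c : RN N) {r δ : ℝ} (hr : 0 < r) (hδ : 0 < δ) (hδ1 : δ < 1) :
    volume (Metric.closedBall c r \ Metric.closedBall c ((1 - δ) * r)) =
      ENNReal.ofReal (1 - (1 - δ) ^ N) * volume (Metric.closedBall c r) := by
  have h1 : volume (Metric.closedBall c ((1 - δ) * r)) =
      ENNReal.ofReal ((1 - δ) ^ N) * volume (Metric.closedBall c r) := by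
    rw [Measure.addHaar_closedBall_mul _ _ (by linarith) hr.le,
        ← Measure.addHaar_closedBall_center volume c r]
    simp
  rw [measure_sdiff (Metric.closedBall_subset_closedBall (by nlinarith))
    Metric.isClosed_closedBall.measurableSet.nullMeasurableSet measure_closedBall_lt_top.ne, h1,
    ENNReal.ofReal_sub _ (by have : 0 < 1 - δ := by linarith
                             positivity), ENNReal.ofReal_one,
    ENNReal.sub_mul fun _ _ => measure_closedBall_lt_top.ne, one_mul]

/-- A quantitative Lusin theorem for gradients (Alberti): a continuous field of covectors is
approximated on most of `K` by the gradient of a uniformly small smooth function whose gradient is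
small in `L^p` off `K`. -/
lemma exists_smooth_gradient_approx {N : ℕ} {p : ℝ≥0∞} (hp : 1 ≤ p) (hp' : p ≠ ∞)
    {K : Set (RN N)} (hK : IsCompact K) {η : ℝ≥0∞} (hη : 0 < η) :
    ∃ A : ℝ, 0 < A ∧ ∀ G : RN N → (RN N →L[ℝ] ℝ), Continuous G → ∀ ε : ℝ, 0 < ε →
      ∃ g : RN N → ℝ, ContDiff ℝ (⊤ : ℕ∞) g ∧ tsupport g ⊆ Metric.cthickening 1 K ∧
        (∀ x, |g x| ≤ ε) ∧
        eLpNorm (fderiv ℝ g) p (volume.restrict Kᶜ) ≤ ENNReal.ofReal ε ∧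
        eLpNorm (fderiv ℝ g) 1 (volume.restrict Kᶜ) ≤ ENNReal.ofReal ε ∧
        (∀ x M, (∀ y, dist y x ≤ ε → ‖G y‖ ≤ M) → ‖fderiv ℝ g x‖ ≤ A * M) ∧
        volume {x ∈ K | ε < ‖fderiv ℝ g x - G x‖} ≤ η := by
  set V : ℝ≥0∞ := volume (Metric.cthickening 1 K) with hV
  have hVtop : V ≠ ∞ := hK.cthickening.measure_ne_top
  have hη2 : 0 < η / 2 := ENNReal.half_pos hη.ne'
  -- `δ`, and with it `A`, is fixed before `G` and `ε` are given. The later iteration depends on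
  -- this order.
  obtain ⟨δ, hδ, hδ1, hδV⟩ := exists_measure_shell_le (N := N) hVtop hη2
  obtain ⟨A, hA, hcell⟩ := exists_cell (N := N) hδ hδ1
  refine ⟨A, hA, fun G hG ε hε => ?_⟩
  obtain ⟨M₀, hM₀⟩ := hK.exists_bound_of_continuousOn hG.continuousOn
  set M : ℝ := max M₀ 1 with hM
  have hM1 : 1 ≤ M := le_max_right _ _
  have hMK : ∀ x ∈ K, ‖G x‖ ≤ M := fun x hx => (hM₀ x hx).trans (le_max_left _ _)
  obtain ⟨ρ₀, hρ₀, hunif⟩ : ∃ ρ > 0, ∀ x ∈ K, ∀ y, dist x y < ρ → dist (G x) (G y) < ε := by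
    have := hK.uniformContinuousAt_of_continuousAt G (fun x _ => hG.continuousAt)
      (Metric.dist_mem_uniformity hε)
    obtain ⟨ρ, hρ, h⟩ := Metric.mem_uniformity_dist.1 this
    exact ⟨ρ, hρ, fun x hx y hxy => h hxy hx⟩
  -- Off `K` the gradient is at most `A * M` and lives on a set of measure at most `κ * V`; `κ` is
  -- chosen to make the resulting norms small for both exponents `p` and 1.
  have hsmall : ∀ q : ℝ≥0∞, 1 ≤ q → q ≠ ∞ → ∀ᶠ κ : ℝ≥0∞ in nhdsWithin 0 (Ioi 0),
      ‖A * M‖ₑ * (κ * V) ^ (1 / q.toReal) ≤ ENNReal.ofReal ε := by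
    intro q hq hq'
    have hq0 : 0 < 1 / q.toReal :=
      one_div_pos.2 (ENNReal.toReal_pos (zero_lt_one.trans_le hq).ne' hq')
    have h1 : Filter.Tendsto (fun κ : ℝ≥0∞ => ‖A * M‖ₑ * (κ * V) ^ (1 / q.toReal)) (nhds 0)
        (nhds (‖A * M‖ₑ * (0 * V) ^ (1 / q.toReal))) := by
      refine ENNReal.Tendsto.const_mul ?_ (Or.inr enorm_ne_top)
      refine (ENNReal.continuous_rpow_const.tendsto _).comp ?_
      exact ENNReal.Tendsto.mul_const Filter.tendsto_id (Or.inr hVtop)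
    rw [zero_mul, ENNReal.zero_rpow_of_pos hq0, mul_zero] at h1
    exact (h1.mono_left nhdsWithin_le_nhds).eventually (ge_mem_nhds (ENNReal.ofReal_pos.2 hε))
  obtain ⟨κ, ⟨hκp, hκ1⟩, hκ⟩ := (((hsmall p hp hp').and (hsmall 1 le_rfl ENNReal.one_ne_top)).and
    self_mem_nhdsWithin).exists
  -- `ρ ≤ 1` keeps the balls in the thickening, `M ρ ≤ ε` bounds the function, `ρ ≤ ε` localizes the
  -- gradient bound, and `ρ < ρ₀` makes `G` nearly constant on each ball.
  set ρ : ℝ := min (min 1 (ε / M)) (min ε (ρ₀ / 2)) with hρ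
  have hρpos : 0 < ρ := by
    have : 0 < ε / M := by positivity
    simp only [hρ, lt_min_iff]
    exact ⟨⟨one_pos, this⟩, hε, by linarith⟩
  have hρ1 : ρ ≤ 1 := (min_le_left _ _).trans (min_le_left _ _)
  have hρM : M * ρ ≤ ε := by
    have : ρ ≤ ε / M := (min_le_left _ _).trans (min_le_right _ _)
    rw [le_div_iff₀ (by linarith)] at this
    linarith
  have hρε : ρ ≤ ε := (min_le_right _ _).trans (min_le_left _ _)
  have hρρ₀ : ρ < ρ₀ := lt_of_le_of_lt ((min_le_right _ _).trans (min_le_right _ _)) (by linarith)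
  obtain ⟨s, r, hs, hdisj, hcov, hsum, hKc⟩ := exists_finite_balls hK hκ hη2 hρpos hρ1
  choose! g hgs hgt hgb hgd hgL using fun (c : RN N) (hc : c ∈ s) => hcell (G c) c (r c)
      (hs c hc).2.1
  have hzero : ∀ c ∈ s, ∀ x ∉ Metric.closedBall c (r c), g c x = 0 ∧ fderiv ℝ (g c) x = 0 :=
    fun c hc x hx => ⟨image_eq_zero_of_notMem_tsupport fun h => hx (hgt c hc h),
      image_eq_zero_of_notMem_tsupport fun h => hx (hgt c hc (tsupport_fderiv_subset ℝ h))⟩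
  set f : RN N → ℝ := fun x => ∑ c ∈ s, g c x with hf
  have hfd : ∀ x, fderiv ℝ f x = ∑ c ∈ s, fderiv ℝ (g c) x := fun x =>
    fderiv_fun_sum fun c hc => (hgs c hc).differentiable (by simp) x
  have hout : ∀ x ∉ ⋃ c ∈ s, Metric.closedBall c (r c), f x = 0 ∧ fderiv ℝ f x = 0 := by
    intro x hx
    simp only [mem_iUnion, not_exists] at hx
    rw [hfd]
    exact ⟨Finset.sum_eq_zero fun c hc => (hzero c hc x (hx c hc)).1,
      Finset.sum_eq_zero fun c hc => (hzero c hc x (hx c hc)).2⟩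
  have hin : ∀ c ∈ s, ∀ x ∈ Metric.closedBall c (r c),
      f x = g c x ∧ fderiv ℝ f x = fderiv ℝ (g c) x := by
    intro c hc x hx
    have h1 : ∀ c' ∈ s, c' ≠ c → x ∉ Metric.closedBall c' (r c') := fun c' hc' hne hx' =>
      disjoint_left.1 (hdisj hc' hc hne) hx' hx
    rw [hfd]
    exact ⟨Finset.sum_eq_single_of_mem c hc fun c' hc' hne => (hzero c' hc' x (h1 c' hc' hne)).1,
      Finset.sum_eq_single_of_mem c hc fun c' hc' hne => (hzero c' hc' x (h1 c' hc' hne)).2⟩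
  have hgrad : ∀ x, ‖fderiv ℝ f x‖ ≤
      ‖(⋃ c ∈ s, Metric.closedBall c (r c)).indicator (fun _ => A * M) x‖ := by
    intro x
    by_cases hx : x ∈ ⋃ c ∈ s, Metric.closedBall c (r c)
    · rw [indicator_of_mem hx, Real.norm_of_nonneg (by positivity)]
      obtain ⟨c, hc, hxc⟩ := mem_iUnion₂.1 hx
      rw [(hin c hc x hxc).2]
      refine (hgd c hc x).trans ?_
      gcongr
      exact hMK c (hs c hc).1
    · rw [indicator_of_notMem hx, (hout x hx).2, norm_zero, norm_zero]
  have hnorm : ∀ q : ℝ≥0∞, ‖A * M‖ₑ * (κ * V) ^ (1 / q.toReal) ≤ ENNReal.ofReal ε →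
      eLpNorm (fderiv ℝ f) q (volume.restrict Kᶜ) ≤ ENNReal.ofReal ε := by
    intro q hq
    refine (eLpNorm_mono hgrad).trans ((eLpNorm_indicator_const_le _ _).trans (le_trans ?_ hq))
    gcongr
    rw [Measure.restrict_apply' hK.measurableSet.compl, inter_comm]
    exact hKc
  refine ⟨f, ContDiff.sum fun c hc => hgs c hc, ?_, fun x => ?_, hnorm p hκp, hnorm 1 hκ1,
    fun x m hm => ?_, ?_⟩
  · refine closure_minimal (fun x hx => ?_) Metric.isClosed_cthickening
    have h1 : x ∈ ⋃ c ∈ s, Metric.closedBall c (r c) := by_contra fun h => hx (hout x h).1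
    obtain ⟨c, hc, hxc⟩ := mem_iUnion₂.1 h1
    exact Metric.closedBall_subset_cthickening (hs c hc).1 1
      (Metric.closedBall_subset_closedBall ((hs c hc).2.2.trans hρ1) hxc)
  · by_cases hx : x ∈ ⋃ c ∈ s, Metric.closedBall c (r c)
    · obtain ⟨c, hc, hxc⟩ := mem_iUnion₂.1 hx
      rw [(hin c hc x hxc).1]
      refine (hgb c hc x).trans (le_trans ?_ hρM)
      gcongr
      · exact (hs c hc).2.1.le
      · exact hMK c (hs c hc).1
      · exact (hs c hc).2.2
    · rw [(hout x hx).1, abs_zero]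
      exact hε.le
  · by_cases hx : x ∈ ⋃ c ∈ s, Metric.closedBall c (r c)
    · obtain ⟨c, hc, hxc⟩ := mem_iUnion₂.1 hx
      rw [(hin c hc x hxc).2]
      refine (hgd c hc x).trans ?_
      gcongr
      refine hm c ?_
      rw [dist_comm]
      exact (Metric.mem_closedBall.1 hxc).trans ((hs c hc).2.2.trans hρε)
    · rw [(hout x hx).2, norm_zero]
      have : 0 ≤ m := (norm_nonneg _).trans (hm x (by simpa using hε.le))
      positivity
  · have hbad : {x ∈ K | ε < ‖fderiv ℝ f x - G x‖} ⊆
        (K \ ⋃ c ∈ s, Metric.closedBall c (r c)) ∪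
          ⋃ c ∈ s, (Metric.closedBall c (r c) \ Metric.closedBall c ((1 - δ) * r c)) := by
      rintro x ⟨hxK, hx⟩
      by_cases h1 : x ∈ ⋃ c ∈ s, Metric.closedBall c (r c)
      · obtain ⟨c, hc, hxc⟩ := mem_iUnion₂.1 h1
        refine Or.inr (mem_iUnion₂.2 ⟨c, hc, hxc, fun h2 => ?_⟩)
        rw [(hin c hc x hxc).2, hgL c hc x h2, ← dist_eq_norm] at hx
        refine absurd (hunif c (hs c hc).1 x ?_) (not_lt.2 hx.le)
        rw [dist_comm]
        exact lt_of_le_of_lt ((Metric.mem_closedBall.1 hxc).trans (hs c hc).2.2) hρρ₀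
      · exact Or.inl ⟨hxK, h1⟩
    refine (measure_mono hbad).trans ((measure_union_le _ _).trans ?_)
    rw [← ENNReal.add_halves η]
    refine add_le_add hcov ((measure_biUnion_finset_le _ _).trans ?_)
    rw [Finset.sum_congr rfl fun c hc => volume_shell c (hs c hc).2.1 hδ hδ1, ← Finset.mul_sum]
    refine le_trans ?_ hδV
    gcongr

/-! ### A continuous function with prescribed derivative on `K`. -/

/-- Smooth functions whose gradients tend to `F` on `K` so fast that the limit function has the
derivative `F` almost everywhere on `K`, while off `K` the gradients form a Cauchy sequence. -/
lemma exists_gradient_sequence {N : ℕ} {p : ℝ≥0∞} (hp : 1 ≤ p) (hp' : p ≠ ∞)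
    {K : Set (RN N)} (hK : IsCompact K) (F : RN N →L[ℝ] ℝ) {τ : ℝ} (hτ : 0 < τ) :
    ∃ (S : ℕ → RN N → ℝ) (e : ℕ → ℝ), S 0 = 0 ∧ (∀ m, ContDiff ℝ (⊤ : ℕ∞) (S m)) ∧
      (∀ m, 0 < e m ∧ e m ≤ τ * (1 / 2) ^ m) ∧
      (∀ m, ∀ x ∉ Metric.cthickening 1 K, S m x = 0) ∧
      (∀ m x, |S (m + 1) x - S m x| ≤ e m) ∧
      (∀ m, eLpNorm (fun x => fderiv ℝ (S (m + 1)) x - fderiv ℝ (S m) x) p (volume.restrict Kᶜ) ≤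
        ENNReal.ofReal (e m)) ∧
      (∀ m, eLpNorm (fun x => fderiv ℝ (S (m + 1)) x - fderiv ℝ (S m) x) 1 (volume.restrict Kᶜ) ≤
        ENNReal.ofReal (e m)) ∧
      (∀ m, volume {x ∈ K | e m < ‖fderiv ℝ (S (m + 1)) x - F‖} ≤ (1 / 2) ^ m) ∧
      ∀ m, ∀ x ∈ K, ‖fderiv ℝ (S (m + 1)) x - F‖ ≤ e m → ∀ y,
        |(S (m + 2) y - S (m + 1) y) - (S (m + 2) x - S (m + 1) x)| ≤ (1 / 2) ^ m * ‖y - x‖ := by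
  have hη : ∀ m : ℕ, (0 : ℝ≥0∞) < (1 / 2) ^ m := fun m => by
    refine ENNReal.pow_pos ?_ m
    simp
  choose A hA hstep using fun m => exists_smooth_gradient_approx hp hp' hK (hη m)
  -- A state is the current partial sum together with the tolerance for the next correction, which
  -- approximates the residual `F - fderiv ℝ S`.
  let St := {q : (RN N → ℝ) × ℝ // ContDiff ℝ (⊤ : ℕ∞) q.1 ∧ 0 < q.2}
  have key : ∀ (m : ℕ) (q : St), ∃ q' : St,
      (∀ x ∉ Metric.cthickening 1 K, q'.1.1 x - q.1.1 x = 0) ∧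
      (∀ x, |q'.1.1 x - q.1.1 x| ≤ q.1.2) ∧
      (eLpNorm (fun x => fderiv ℝ q'.1.1 x - fderiv ℝ q.1.1 x) p (volume.restrict Kᶜ) ≤
        ENNReal.ofReal q.1.2) ∧
      (eLpNorm (fun x => fderiv ℝ q'.1.1 x - fderiv ℝ q.1.1 x) 1 (volume.restrict Kᶜ) ≤
        ENNReal.ofReal q.1.2) ∧
      (∀ x M, (∀ y, dist y x ≤ q.1.2 → ‖F - fderiv ℝ q.1.1 y‖ ≤ M) →
        ‖fderiv ℝ q'.1.1 x - fderiv ℝ q.1.1 x‖ ≤ A m * M) ∧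
      (volume {x ∈ K | q.1.2 < ‖fderiv ℝ q'.1.1 x - F‖} ≤ (1 / 2) ^ m) ∧
      -- The new tolerance is small relative to the scale `ρ` on which the new gradient varies by
      -- less than the old tolerance, so the next correction is negligible at distances beyond that
      -- scale.
      (∃ ρ > 0, q'.1.2 ≤ ρ / 4 * (1 / 2) ^ m ∧ ∀ x ∈ K, ∀ y, dist x y < ρ →
        dist (fderiv ℝ q'.1.1 x) (fderiv ℝ q'.1.1 y) < q.1.2) ∧
      -- The index is `m + 2` because the tolerance chosen here, `e (m + 1)`, bounds the residual of
      -- `S (m + 2)` off the bad set, and that residual is corrected at step `m + 2`.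
      q'.1.2 ≤ τ * (1 / 2) ^ (m + 1) ∧ A (m + 2) * (2 * q'.1.2) ≤ (1 / 2) ^ (m + 1) := by
    rintro m ⟨⟨S, e⟩, hS, he⟩
    simp only at hS he
    have hG : Continuous fun x => F - fderiv ℝ S x :=
      continuous_const.sub (hS.continuous_fderiv (by simp))
    obtain ⟨g, hg, hgs, hgb, hgp, hg1, hgA, hgη⟩ := hstep m _ hG e he
    have hS' : ContDiff ℝ (⊤ : ℕ∞) (S + g) := hS.add hg
    have hd : ∀ x, fderiv ℝ (S + g) x = fderiv ℝ S x + fderiv ℝ g x := fun x =>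
      fderiv_add (hS.differentiable (by simp) x) (hg.differentiable (by simp) x)
    obtain ⟨ρ, hρ, hunif⟩ : ∃ ρ > 0, ∀ x ∈ K, ∀ y, dist x y < ρ →
        dist (fderiv ℝ (S + g) x) (fderiv ℝ (S + g) y) < e := by
      have := hK.uniformContinuousAt_of_continuousAt (fderiv ℝ (S + g))
        (fun x _ => (hS'.continuous_fderiv (by simp)).continuousAt) (Metric.dist_mem_uniformity he)
      obtain ⟨ρ, hρ, h⟩ := Metric.mem_uniformity_dist.1 this
      exact ⟨ρ, hρ, fun x hx y hxy => h hxy hx⟩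
    have hA2 := hA (m + 2)
    refine ⟨⟨⟨S + g, min (ρ / 4 * (1 / 2) ^ m) (min (τ * (1 / 2) ^ (m + 1))
      ((1 / 2) ^ (m + 1) / (2 * A (m + 2))))⟩, hS', ?_⟩, ?_, ?_, ?_, ?_, ?_, ?_, ?_, ?_, ?_⟩
    · simp only [lt_min_iff]
      refine ⟨by positivity, by positivity, by positivity⟩
    · intro x hx
      simp only [Pi.add_apply, add_sub_cancel_left]
      exact image_eq_zero_of_notMem_tsupport fun h => hx (hgs h)
    · intro x
      simpa using hgb x
    · simpa [hd] using hgp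
    · simpa [hd] using hg1
    · intro x M hM
      simpa [hd] using hgA x M hM
    · have : ∀ x, fderiv ℝ (S + g) x - F = fderiv ℝ g x - (F - fderiv ℝ S x) := fun x => by
        rw [hd]; abel
      simpa only [this] using hgη
    · exact ⟨ρ, hρ, min_le_left _ _, hunif⟩
    · exact (min_le_right _ _).trans (min_le_left _ _)
    · have h1 : min (ρ / 4 * (1 / 2) ^ m) (min (τ * (1 / 2) ^ (m + 1))
        ((1 / 2) ^ (m + 1) / (2 * A (m + 2)))) ≤ (1 / 2) ^ (m + 1) / (2 * A (m + 2)) :=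
        (min_le_right _ _).trans (min_le_right _ _)
      rw [le_div_iff₀ (by positivity)] at h1
      simp only
      linarith
  choose nxt hnxt using key
  have hA1 := hA 1
  let q : ℕ → St := fun m => Nat.rec
    (⟨⟨0, min τ (1 / (2 * A 1))⟩, contDiff_const, lt_min hτ (by positivity)⟩) (fun m q => nxt m q) m
  have hq : ∀ m, q (m + 1) = nxt m (q m) := fun m => rfl
  have hP := fun m => hnxt m (q m)
  simp only [← hq] at hP
  have heA : ∀ m, A (m + 1) * (2 * (q m).1.2) ≤ (1 / 2) ^ m := by
    rintro (_ | m)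
    · have h1 : (q 0).1.2 ≤ 1 / (2 * A 1) := min_le_right _ _
      rw [le_div_iff₀ (by positivity)] at h1
      simp only [zero_add, pow_zero]
      linarith
    · exact (hP m).2.2.2.2.2.2.2.2
  have heτ : ∀ m, (q m).1.2 ≤ τ * (1 / 2) ^ m := by
    rintro (_ | m)
    · rw [pow_zero, mul_one]
      exact min_le_left _ _
    · exact (hP m).2.2.2.2.2.2.2.1
  refine ⟨fun m => (q m).1.1, fun m => (q m).1.2, rfl, fun m => (q m).2.1,
    fun m => ⟨(q m).2.2, heτ m⟩, fun m => ?_, fun m => (hP m).2.1, fun m => (hP m).2.2.1,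
    fun m => (hP m).2.2.2.1, fun m => (hP m).2.2.2.2.2.1, fun m x hx hxe y => ?_⟩
  · induction m with
    | zero => exact fun _ _ => rfl
    | succ m ih =>
      intro x hx
      have h1 := (hP m).1 x hx
      have h2 := ih x hx
      simp only at h2
      rw [h2, sub_zero] at h1
      exact h1
  · obtain ⟨ρ, hρ, hle, hunif⟩ := (hP m).2.2.2.2.2.2.1
    have hb := (hP (m + 1)).2.1
    have hgr := (hP (m + 1)).2.2.2.2.1
    simp only at hxe
    change |((q (m + 2)).1.1 y - (q (m + 1)).1.1 y) - ((q (m + 2)).1.1 x - (q (m + 1)).1.1 x)| ≤ _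
    have hpow : (1 / 2 : ℝ) ^ m ≤ 1 := pow_le_one₀ (by norm_num) (by norm_num)
    have hpow0 : (0 : ℝ) < (1 / 2) ^ m := by positivity
    have hsm : (q (m + 1)).1.2 ≤ ρ / 4 := hle.trans (mul_le_of_le_one_right (by linarith) hpow)
    -- Near `x` the residual of `S (m + 1)` is at most twice `e m`, so the correction has gradient
    -- at most `(1 / 2) ^ m` and the mean value inequality applies. Far from `x` the two values of
    -- the correction are each at most `ρ / 4 * (1 / 2) ^ m`.
    rcases lt_or_ge ‖y - x‖ (ρ / 2) with hyx | hyx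
    · have hdiff : ∀ z ∈ Metric.ball x (ρ / 2), HasFDerivWithinAt
          (fun z => (q (m + 2)).1.1 z - (q (m + 1)).1.1 z)
          (fderiv ℝ (q (m + 2)).1.1 z - fderiv ℝ (q (m + 1)).1.1 z) (Metric.ball x (ρ / 2)) z :=
        fun z _ => (((q (m + 2)).2.1.differentiable (by simp) z).hasFDerivAt.sub
          ((q (m + 1)).2.1.differentiable (by simp) z).hasFDerivAt).hasFDerivWithinAt
      have hbound : ∀ z ∈ Metric.ball x (ρ / 2),
          ‖fderiv ℝ (q (m + 2)).1.1 z - fderiv ℝ (q (m + 1)).1.1 z‖ ≤ (1 / 2) ^ m := by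
        intro z hz
        refine (hgr z (2 * (q m).1.2) fun w hw => ?_).trans (heA m)
        rw [Metric.mem_ball] at hz
        have h1 : dist x w < ρ := by
          have := dist_triangle w z x
          rw [dist_comm]
          linarith
        have h2 := hunif x hx w h1
        rw [dist_eq_norm] at h2
        have h3 : F - fderiv ℝ (q (m + 1)).1.1 w = (fderiv ℝ (q (m + 1)).1.1 x -
          fderiv ℝ (q (m + 1)).1.1 w) - (fderiv ℝ (q (m + 1)).1.1 x - F) := by abel
        rw [h3]
        refine (norm_sub_le _ _).trans ?_
        linarith
      have := (convex_ball x (ρ / 2)).norm_image_sub_le_of_norm_hasFDerivWithin_le hdiff hbound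
        (Metric.mem_ball_self (by linarith)) (by rwa [Metric.mem_ball, dist_eq_norm] : y ∈ _)
      simpa only [Real.norm_eq_abs] using this
    · have h1 := hb y
      have h2 := hb x
      have h3 := abs_sub (((q (m + 2)).1.1 y - (q (m + 1)).1.1 y))
        ((q (m + 2)).1.1 x - (q (m + 1)).1.1 x)
      have h4 : ρ / 2 * (1 / 2) ^ m ≤ ‖y - x‖ * (1 / 2) ^ m := by gcongr
      have h5 : |((q (m + 2)).1.1 y - (q (m + 1)).1.1 y)| ≤ (q (m + 1)).1.2 := h1
      have h6 : |((q (m + 2)).1.1 x - (q (m + 1)).1.1 x)| ≤ (q (m + 1)).1.2 := h2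
      linarith

/-- A telescoping bound for a convergent sequence. -/
lemma abs_sub_le_of_tendsto {a : ℕ → ℝ} {l C : ℝ} (n : ℕ)
    (h : ∀ k, n ≤ k → |a (k + 1) - a k| ≤ C * (1 / 2) ^ k)
    (ha : Filter.Tendsto a Filter.atTop (nhds l)) : |l - a n| ≤ 2 * C * (1 / 2) ^ n := by
  have h1 : ∀ j, dist (a (n + j)) (a (n + (j + 1))) ≤ C * (1 / 2) ^ n * (1 / 2) ^ j := fun j => by
    rw [dist_comm, Real.dist_eq, mul_assoc, ← pow_add, ← add_assoc]
    exact h _ (by omega)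
  have h2 := dist_le_of_le_geometric_of_tendsto₀ (f := fun j => a (n + j)) (1 / 2)
    (C * (1 / 2) ^ n) (by norm_num) h1 (a := l)
    ((Filter.tendsto_add_atTop_iff_nat n).2 ha |>.congr fun j => by rw [add_comm])
  rw [add_zero, dist_comm, Real.dist_eq] at h2
  exact h2.trans (le_of_eq (by ring))

/-- The increment of `f - F` splits into the tail of the corrections, the differentiability error of
`S (m + 1)`, and the gradient error `e m`. The tail is at most `2 * (1 / 2) ^ m * ‖y - x‖` for all
`y`, so a single large `m` suffices. -/
lemma hasFDerivAt_of_gradient_sequence {N : ℕ} {S : ℕ → RN N → ℝ} {f : RN N → ℝ}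
    {F : RN N →L[ℝ] ℝ} {x : RN N} {e : ℕ → ℝ} (hS : ∀ m, DifferentiableAt ℝ (S m) x)
    (hf : ∀ y, Filter.Tendsto (fun m => S m y) Filter.atTop (nhds (f y)))
    (he : Filter.Tendsto e Filter.atTop (nhds 0))
    (h1 : ∀ᶠ m in Filter.atTop, ‖fderiv ℝ (S (m + 1)) x - F‖ ≤ e m)
    (h2 : ∀ᶠ m in Filter.atTop, ∀ y,
      |(S (m + 2) y - S (m + 1) y) - (S (m + 2) x - S (m + 1) x)| ≤ (1 / 2) ^ m * ‖y - x‖) :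
    HasFDerivAt f F x := by
  rw [hasFDerivAt_iff_isLittleO, Asymptotics.isLittleO_iff]
  intro c hc
  obtain ⟨m₀, hm₀⟩ := Filter.eventually_atTop.1 h2
  have hpow : Filter.Tendsto (fun m : ℕ => 2 * (1 / 2 : ℝ) ^ m) Filter.atTop (nhds 0) := by
    simpa using (tendsto_pow_atTop_nhds_zero_of_lt_one (r := (1 / 2 : ℝ)) (by norm_num)
      (by norm_num)).const_mul 2
  obtain ⟨m, ⟨⟨hm1, hm2⟩, hm3⟩, hm4⟩ := (((h1.and (he.eventually (gt_mem_nhds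
    (show 0 < c / 3 by positivity)))).and (hpow.eventually (gt_mem_nhds
    (show 0 < c / 3 by positivity)))).and (Filter.eventually_ge_atTop m₀)).exists
  have htail : ∀ y, |(f y - f x) - (S (m + 1) y - S (m + 1) x)| ≤ 2 * (1 / 2) ^ m * ‖y - x‖ := by
    intro y
    have := abs_sub_le_of_tendsto (a := fun k => S k y - S k x) (C := 2 * ‖y - x‖) (m + 1)
      (fun k hk => ?_) ((hf y).sub (hf x))
    · refine this.trans (le_of_eq ?_)
      rw [pow_succ]
      ring
    · obtain ⟨j, rfl⟩ : ∃ j, k = j + 1 := ⟨k - 1, by omega⟩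
      have h3 := hm₀ j (by omega) y
      have e1 : S (j + 1 + 1) y - S (j + 1 + 1) x - (S (j + 1) y - S (j + 1) x)
        = (S (j + 2) y - S (j + 1) y) - (S (j + 2) x - S (j + 1) x) := by ring
      rw [e1]
      refine h3.trans (le_of_eq ?_)
      rw [pow_succ]
      ring
  have h3 := (hasFDerivAt_iff_isLittleO.1 (hS (m + 1)).hasFDerivAt)
  rw [Asymptotics.isLittleO_iff] at h3
  filter_upwards [h3 (c := c / 3) (by positivity)] with y hy
  have h4 : ‖(fderiv ℝ (S (m + 1)) x - F) (y - x)‖ ≤ c / 3 * ‖y - x‖ :=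
    (ContinuousLinearMap.le_opNorm _ _).trans (by gcongr; linarith)
  have h5 : 2 * (1 / 2) ^ m * ‖y - x‖ ≤ c / 3 * ‖y - x‖ := by gcongr
  have e1 : f y - f x - F (y - x) = ((f y - f x) - (S (m + 1) y - S (m + 1) x)) +
      (S (m + 1) y - S (m + 1) x - fderiv ℝ (S (m + 1)) x (y - x)) +
      (fderiv ℝ (S (m + 1)) x - F) (y - x) := by
    rw [sub_apply]
    ring
  rw [e1]
  refine (norm_add₃_le).trans ?_
  have h6 := htail y
  rw [← Real.norm_eq_abs] at h6
  linarith

/-- The test function lies in the conjugate Lebesgue space, so Hölder gives `L^1` convergence of the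
products. -/
lemma tendsto_integral_mul_of_tendsto_eLpNorm {N : ℕ} {p : ℝ≥0∞} (hp : 1 ≤ p)
    {μ : Measure (RN N)} [IsFiniteMeasureOnCompacts μ] {D : ℕ → RN N → ℝ} {g ψ : RN N → ℝ}
    (hD : ∀ m, MemLp (D m) p μ) (hg : MemLp g p μ)
    (h : Filter.Tendsto (fun m => eLpNorm (D m - g) p μ) Filter.atTop (nhds 0))
    (hψ : Continuous ψ) (hc : HasCompactSupport ψ) :
    Filter.Tendsto (fun m => ∫ x, D m x * ψ x ∂μ) Filter.atTop (nhds (∫ x, g x * ψ x ∂μ)) := by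
  have hψq : MemLp ψ (ENNReal.conjExponent p) μ := hψ.memLp_of_hasCompactSupport hc
  have hconj : ENNReal.HolderConjugate p (ENNReal.conjExponent p) := .conjExponent hp
  have i1 : ∀ m, Integrable (fun x => D m x * ψ x) μ := fun m =>
    ((hD m).locallyIntegrable hp).integrable_mul_of_hasCompactSupport hψ hc
  have i2 : Integrable (fun x => g x * ψ x) μ :=
    (hg.locallyIntegrable hp).integrable_mul_of_hasCompactSupport hψ hc
  refine tendsto_integral_of_L1 _ i2.aestronglyMeasurable (Filter.Eventually.of_forall i1) ?_
  have h1 : Filter.Tendsto (fun m => eLpNorm (D m - g) p μ * eLpNorm ψ (ENNReal.conjExponent p) μ)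
      Filter.atTop (nhds 0) := by
    have := ENNReal.Tendsto.mul_const h (Or.inr hψq.eLpNorm_ne_top)
    rwa [zero_mul] at this
  refine tendsto_of_tendsto_of_tendsto_of_le_of_le tendsto_const_nhds h1 (fun _ => zero_le)
    fun m => ?_
  have h2 := eLpNorm_smul_le_mul_eLpNorm (p := p) (q := ENNReal.conjExponent p) (r := 1)
    (f := ψ) (φ := D m - g) hψq.aestronglyMeasurable ((hD m).sub hg).aestronglyMeasurable
  refine le_trans (le_of_eq ?_) h2
  rw [eLpNorm_one_eq_lintegral_enorm]
  congr 1
  ext x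
  simp [sub_mul]

lemma integral_mul_fderiv_apply_eq_neg {N : ℕ} {s φ : RN N → ℝ} (hs : ContDiff ℝ (⊤ : ℕ∞) s)
    (hφ : ContDiff ℝ (⊤ : ℕ∞) φ) (hc : HasCompactSupport φ) (v : RN N) :
    ∫ x, s x * fderiv ℝ φ x v = - ∫ x, fderiv ℝ s x v * φ x := by
  refine integral_mul_fderiv_eq_neg_fderiv_mul_of_integrable ?_ ?_ ?_
    (fun x _ => hs.differentiable (by simp) x) (fun x _ => hφ.differentiable (by simp) x)
  · exact ((continuous_fderiv_apply hs v).mul hφ.continuous).integrable_of_hasCompactSupport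
      hc.mul_left
  · exact (hs.continuous.mul (continuous_fderiv_apply hφ v)).integrable_of_hasCompactSupport
      (hc.fderiv_apply' v).mul_left
  · exact (hs.continuous.mul hφ.continuous).integrable_of_hasCompactSupport hc.mul_left

/-- A sequence with summable increments in `L^p` converges in `L^p`. -/
lemma exists_tendsto_eLpNorm {α : Type*} [MeasurableSpace α] {μ : Measure α} {p : ℝ≥0∞}
    (hp : 1 ≤ p) {D : ℕ → α → ℝ} (hD : ∀ m, MemLp (D m) p μ) {B : ℕ → ℝ≥0∞}
    (hB : ∑' m, B m ≠ ∞) (h : ∀ m, eLpNorm (D (m + 1) - D m) p μ ≤ B m) :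
    ∃ g, MemLp g p μ ∧ Filter.Tendsto (fun m => eLpNorm (D m - g) p μ) Filter.atTop (nhds 0) := by
  have : Fact (1 ≤ p) := ⟨hp⟩
  have hcau : CauchySeq fun m => (hD m).toLp (D m) := by
    refine cauchySeq_of_edist_le_of_tsum_ne_top B (fun m => ?_) hB
    rw [edist_comm, Lp.edist_toLp_toLp]
    exact h m
  obtain ⟨G, hG⟩ := cauchySeq_tendsto_of_complete hcau
  refine ⟨G, Lp.memLp G, ?_⟩
  have := (Lp.tendsto_Lp_iff_tendsto_eLpNorm' _ _).1 hG
  refine this.congr fun m => eLpNorm_congr_ae ?_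
  filter_upwards [(hD m).coeFn_toLp] with x hx
  simp [hx]

/-- On a compact set of positive measure there is a continuous counterexample to removability that
has classical partial derivatives almost everywhere. -/
lemma exists_continuous_memV_not_memW {N : ℕ} (hN : 0 < N) {p : ℝ≥0∞} (hp : 1 ≤ p) (hp' : p ≠ ∞)
    {K : Set (RN N)} (hK : IsCompact K) (hpos : volume K ≠ 0) :
    ∃ f : RN N → ℝ, Continuous f ∧ MemV p f ∧ MemW p Kᶜ f ∧ ¬ MemW p univ f := by
  set j₀ : Fin N := ⟨0, hN⟩ with hj₀
  set F : RN N →L[ℝ] ℝ := EuclideanSpace.proj j₀ with hF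
  have hm := hK.measurableSet
  have hKtop : volume K ≠ ∞ := hK.measure_ne_top
  have hKr : 0 < (volume K).toReal := ENNReal.toReal_pos hpos hKtop
  -- The increments of the gradients off `K` sum in `L^1` to at most `2 * τ`, half the measure of
  -- `K`; this is the margin in the final contradiction.
  set τ : ℝ := (volume K).toReal / 4 with hτ
  have hτ0 : 0 < τ := by positivity
  obtain ⟨S, e, hS0, hS, he, hsupp, hSb, hSp, hS1, hbad, hlip⟩ :=
    exists_gradient_sequence hp hp' hK F hτ0
  have hSb' : ∀ m x, |S (m + 1) x - S m x| ≤ τ * (1 / 2) ^ m := fun m x =>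
    (hSb m x).trans (he m).2
  have hcau : ∀ x, CauchySeq fun m => S m x := fun x =>
    cauchySeq_of_le_geometric (1 / 2) τ (by norm_num) fun m => by
      rw [dist_comm, Real.dist_eq]
      exact hSb' m x
  choose f hf using fun x => cauchySeq_tendsto_of_complete (hcau x)
  have hdist : ∀ m x, |f x - S m x| ≤ 2 * τ * (1 / 2) ^ m := fun m x =>
    abs_sub_le_of_tendsto (a := fun m => S m x) m (fun k _ => hSb' k x) (hf x)
  have hgeo : Filter.Tendsto (fun m : ℕ => 2 * τ * (1 / 2 : ℝ) ^ m) Filter.atTop (nhds 0) := by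
    simpa using (tendsto_pow_atTop_nhds_zero_of_lt_one (r := (1 / 2 : ℝ)) (by norm_num)
      (by norm_num)).const_mul (2 * τ)
  have hfc : Continuous f := by
    refine TendstoUniformly.continuous (F := S) (p := Filter.atTop) ?_
      (Filter.Frequently.of_forall fun m => (hS m).continuous)
    rw [Metric.tendstoUniformly_iff]
    intro ε hε
    filter_upwards [hgeo.eventually (gt_mem_nhds hε)] with m hm x
    rw [Real.dist_eq]
    exact (hdist m x).trans_lt hm
  have hf0 : ∀ x ∉ Metric.cthickening 1 K, f x = 0 := fun x hx =>
    tendsto_nhds_unique (hf x) (by simp [hsupp _ x hx])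
  have hfcs : HasCompactSupport f := HasCompactSupport.intro hK.cthickening hf0
  have hScs : ∀ m, HasCompactSupport (S m) := fun m =>
    HasCompactSupport.intro hK.cthickening (hsupp m)
  have hfL : MemLp f p volume := hfc.memLp_of_hasCompactSupport hfcs
  have he0 : Filter.Tendsto e Filter.atTop (nhds 0) := by
    refine squeeze_zero (fun m => (he m).1.le) (fun m => ?_) hgeo
    have := (he m).2
    have h1 : 0 < τ * (1 / 2 : ℝ) ^ m := by positivity
    linarith
  have hder : ∀ᵐ x, x ∈ K → HasFDerivAt f F x := by
    -- Borel–Cantelli: the bad sets have summable measures.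
    have h1 : ∀ᵐ x, ∀ᶠ m in Filter.atTop, x ∉ {x ∈ K | e m < ‖fderiv ℝ (S (m + 1)) x - F‖} := by
      refine ae_eventually_notMem (ne_top_of_le_ne_top ?_ (ENNReal.tsum_le_tsum hbad))
      rw [ENNReal.tsum_geometric]
      simp
    filter_upwards [h1] with x hx hxK
    have h2 : ∀ᶠ m in Filter.atTop, ‖fderiv ℝ (S (m + 1)) x - F‖ ≤ e m := by
      filter_upwards [hx] with m hm
      exact not_lt.1 fun h => hm ⟨hxK, h⟩
    exact hasFDerivAt_of_gradient_sequence (fun m => (hS m).differentiable (by simp) x) hf he0 h2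
      (h2.mono fun m hm => hlip m x hxK hm)
  have htsum : ∑' m, ENNReal.ofReal (e m) ≤ ENNReal.ofReal (2 * τ) := by
    have hsum : Summable fun m : ℕ => τ * (1 / 2 : ℝ) ^ m := summable_geometric_two.mul_left τ
    refine (ENNReal.tsum_le_tsum fun m => ENNReal.ofReal_le_ofReal (he m).2).trans ?_
    rw [← ENNReal.ofReal_tsum_of_nonneg (fun m => by positivity) hsum, tsum_mul_left,
      tsum_geometric_two, mul_comm]
  have hcomp : ∀ (q : ℝ≥0∞) (m : ℕ) (j : Fin N), eLpNorm ((fun x => fderiv ℝ (S (m + 1)) x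
      (unitVec j)) -
      fun x => fderiv ℝ (S m) x (unitVec j)) q (volume.restrict Kᶜ) ≤
      eLpNorm (fun x => fderiv ℝ (S (m + 1)) x - fderiv ℝ (S m) x) q (volume.restrict Kᶜ) := by
    intro q m j
    refine eLpNorm_mono fun x => ?_
    rw [Pi.sub_apply, ← sub_apply]
    refine (ContinuousLinearMap.le_opNorm _ _).trans ?_
    simp
  have hDL : ∀ (j : Fin N) (m : ℕ), MemLp (fun x => fderiv ℝ (S m) x (unitVec j)) p
      (volume.restrict Kᶜ) := fun j m =>
    ((continuous_fderiv_apply (hS m) _).memLp_of_hasCompactSupport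
      ((hScs m).fderiv_apply' _)).restrict _
  have hlim : ∀ j : Fin N, ∃ g, MemLp g p (volume.restrict Kᶜ) ∧
      Filter.Tendsto (fun m => eLpNorm ((fun x => fderiv ℝ (S m) x (unitVec j)) - g) p
        (volume.restrict Kᶜ)) Filter.atTop (nhds 0) := fun j =>
    exists_tendsto_eLpNorm hp (hDL j) (ne_top_of_le_ne_top ENNReal.ofReal_ne_top htsum)
      fun m => (hcomp p m j).trans (hSp m)
  choose g hgL hg using hlim
  have hwk : ∀ j, IsWeakPartialDeriv Kᶜ j f (g j) := by
    intro j φ hφ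
    have h0 : ∀ x, x ∉ Kᶜ → φ x = 0 := fun x hx =>
      image_eq_zero_of_notMem_tsupport fun h => hx (hφ.2.2 h)
    have h0' : ∀ x, x ∉ Kᶜ → fderiv ℝ φ x (unitVec j) = 0 := fun x hx => by
      rw [image_eq_zero_of_notMem_tsupport (f := fderiv ℝ φ)
        fun h => hx (hφ.2.2 (tsupport_fderiv_subset ℝ h))]
      simp
    have h1 := (tendsto_integral_mul_of_tendsto_eLpNorm hp (hDL j) (hgL j) (hg j)
      hφ.1.continuous hφ.2.1).neg
    have hdφ := continuous_fderiv_apply hφ.1 (unitVec j)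
    have h2 : Filter.Tendsto (fun m => ∫ x in Kᶜ, S m x * fderiv ℝ φ x (unitVec j)) Filter.atTop
        (nhds (∫ x in Kᶜ, f x * fderiv ℝ φ x (unitVec j))) := by
      refine tendsto_integral_of_dominated_convergence
        (fun x => (|f x| + 2 * τ) * |fderiv ℝ φ x (unitVec j)|) (fun m => ?_) ?_ (fun m => ?_) ?_
      · exact ((hS m).continuous.mul hdφ).aestronglyMeasurable
      · refine Integrable.restrict (Continuous.integrable_of_hasCompactSupport ?_ ?_)
        · exact (hfc.abs.add continuous_const).mul hdφ.abs
        · exact (hφ.2.1.fderiv_apply' (unitVec j)).norm.mul_left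
      · refine Filter.Eventually.of_forall fun x => ?_
        rw [norm_mul, Real.norm_eq_abs, Real.norm_eq_abs]
        gcongr
        have h3 := hdist m x
        have h4 : 2 * τ * (1 / 2 : ℝ) ^ m ≤ 2 * τ :=
          mul_le_of_le_one_right (by positivity) (pow_le_one₀ (by norm_num) (by norm_num))
        have h5 := abs_sub_abs_le_abs_sub (S m x) (f x)
        rw [abs_sub_comm] at h5
        linarith
      · exact Filter.Eventually.of_forall fun x => (hf x).mul_const _
    refine tendsto_nhds_unique h2 (h1.congr fun m => ?_)
    rw [setIntegral_eq_integral_of_forall_compl_eq_zero fun x hx => by rw [h0 x hx, mul_zero],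
      setIntegral_eq_integral_of_forall_compl_eq_zero fun x hx => by rw [h0' x hx, mul_zero],
      integral_mul_fderiv_apply_eq_neg (hS m) hφ.1 hφ.2.1]
  have hW : MemW p Kᶜ f := ⟨hfL.restrict _, fun j => ⟨g j, hgL j, hwk j⟩⟩
  have hlines : ∀ v : RN N, v ≠ 0 → ContinuousOnLines v f := fun v _ =>
    Filter.Eventually.of_forall fun y => hfc.comp (by fun_prop)
  have hfin : IsFiniteMeasure (volume.restrict K) := ⟨by simpa using hKtop.lt_top⟩
  refine ⟨f, hfc, hW.memV hp hK hfL hlines fun j => ⟨fun _ => F (unitVec j), memLp_const _,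
    hder.mono fun x hx hxK => (hx hxK).hasLineDerivAt _⟩, hW, fun hWu => ?_⟩
  -- A global weak partial `G` would agree with the pointwise partial almost everywhere, so it is 1
  -- on `K` and `g j₀` off `K`.
  obtain ⟨G, hGL, hG⟩ := hWu.2 j₀
  have hv := unitVec_ne_zero j₀
  have hGu := ae_hasLineDerivAt hv isOpen_univ hfc.measurable.aemeasurable
    (hWu.1.locallyIntegrable_indicator hp MeasurableSet.univ)
    (hGL.locallyIntegrable_indicator hp MeasurableSet.univ) hG (hlines _ hv)
  have hgu := ae_hasLineDerivAt hv hK.isClosed.isOpen_compl hfc.measurable.aemeasurable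
    (hW.1.locallyIntegrable_indicator hp hm.compl)
    ((hgL j₀).locallyIntegrable_indicator hp hm.compl) (hwk j₀) (hlines _ hv)
  have hGK : ∀ᵐ x, x ∈ K → G x = 1 := by
    filter_upwards [hGu, hder] with x h1 h2 hx
    have h3 := (h1 (mem_univ x)).lineDeriv.symm.trans ((h2 hx).hasLineDerivAt
        (unitVec j₀)).lineDeriv
    rw [h3, hF]
    simp
  have hGKc : ∀ᵐ x, x ∈ Kᶜ → G x = g j₀ x := by
    filter_upwards [hGu, hgu] with x h1 h2 hx
    exact (h1 (mem_univ x)).lineDeriv.symm.trans (h2 hx).lineDeriv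
  obtain ⟨R, hR⟩ := (hK.cthickening (r := 1)).isBounded.subset_ball (0 : RN N)
  set R' : ℝ := max R 1 with hR'
  let φ : ContDiffBump (0 : RN N) := ⟨R', R' + 1, lt_of_lt_of_le one_pos (le_max_right _ _),
    by linarith⟩
  have hφc : ContDiff ℝ (⊤ : ℕ∞) φ := φ.contDiff
  have hφt : IsTestFunction univ φ := ⟨hφc, φ.hasCompactSupport, subset_univ _⟩
  have hφ1 : ∀ x ∈ Metric.cthickening 1 K, φ =ᶠ[nhds x] fun _ => 1 := by
    intro x hx
    filter_upwards [Metric.isOpen_ball.mem_nhds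
      (Metric.ball_subset_ball (le_max_left R 1) (hR hx))] with y hy
    exact φ.one_of_mem_closedBall (Metric.ball_subset_closedBall hy)
  -- The cut-off is locally constant wherever `f` may be nonzero, so testing with it forces `∫ G φ =
  -- 0`.
  have hz : ∀ x, f x * fderiv ℝ φ x (unitVec j₀) = 0 := by
    intro x
    by_cases hx : x ∈ Metric.cthickening 1 K
    · rw [(hφ1 x hx).fderiv_eq]
      simp
    · rw [hf0 x hx, zero_mul]
  have hG0 := hG φ hφt
  simp only [hz, integral_zero] at hG0
  simp only [Measure.restrict_univ] at hG0 hGL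
  have iG : Integrable fun x => G x * φ x :=
    (hGL.locallyIntegrable hp).integrable_mul_of_hasCompactSupport hφc.continuous
      φ.hasCompactSupport
  rw [zero_eq_neg, ← integral_add_compl hm iG] at hG0
  have hI1 : ∫ x in K, G x * φ x = (volume K).toReal := by
    rw [setIntegral_congr_ae (g := fun _ => (1 : ℝ)) hm]
    · simp [Measure.real]
    · filter_upwards [hGK] with x h1 hx
      rw [h1 hx, (hφ1 x (Metric.self_subset_cthickening K hx)).self_of_nhds, mul_one]
  have hI2 : ∫ x in Kᶜ, G x * φ x = ∫ x in Kᶜ, g j₀ x * φ x := by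
    refine setIntegral_congr_ae hm.compl ?_
    filter_upwards [hGKc] with x h1 hx
    rw [h1 hx]
  have hD1 : ∀ m, eLpNorm (fun x => fderiv ℝ (S m) x (unitVec j₀)) 1 (volume.restrict Kᶜ) ≤
      ∑ k ∈ Finset.range m, ENNReal.ofReal (e k) := by
    intro m
    induction m with
    | zero => simp [hS0]
    | succ m ih =>
      rw [Finset.sum_range_succ]
      have h1 := eLpNorm_add_le (μ := volume.restrict Kᶜ) (p := 1)
        (continuous_fderiv_apply (hS m) (unitVec j₀)).aestronglyMeasurable
        ((continuous_fderiv_apply (hS (m + 1)) (unitVec j₀)).sub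
          (continuous_fderiv_apply (hS m) (unitVec j₀))).aestronglyMeasurable le_rfl
      have e1 : ((fun x => fderiv ℝ (S m) x (unitVec j₀)) +
          fun x => fderiv ℝ (S (m + 1)) x (unitVec j₀) - fderiv ℝ (S m) x (unitVec j₀)) =
          fun x => fderiv ℝ (S (m + 1)) x (unitVec j₀) := by
        ext x
        simp
      change eLpNorm ((fun x => fderiv ℝ (S m) x (unitVec j₀)) +
          fun x => fderiv ℝ (S (m + 1)) x (unitVec j₀) - fderiv ℝ (S m) x (unitVec j₀)) _ _ ≤
              _ at h1
      rw [e1] at h1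
      exact h1.trans (add_le_add ih ((hcomp 1 m j₀).trans (hS1 m)))
  have hbound : ∀ m, |∫ x in Kᶜ, fderiv ℝ (S m) x (unitVec j₀) * φ x| ≤ 2 * τ := by
    intro m
    have h1 : ENNReal.ofReal |∫ x in Kᶜ, fderiv ℝ (S m) x (unitVec j₀) * φ x| ≤
        ENNReal.ofReal (2 * τ) := by
      rw [← Real.norm_eq_abs, ofReal_norm]
      refine (enorm_integral_le_lintegral_enorm _).trans ?_
      rw [← eLpNorm_one_eq_lintegral_enorm]
      refine le_trans (eLpNorm_mono fun x => ?_)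
        ((hD1 m).trans ((ENNReal.sum_le_tsum _).trans htsum))
      rw [norm_mul, Real.norm_of_nonneg φ.nonneg]
      exact mul_le_of_le_one_right (norm_nonneg _) φ.le_one
    exact (ENNReal.ofReal_le_ofReal_iff (by positivity)).1 h1
  have hfinal : |∫ x in Kᶜ, g j₀ x * φ x| ≤ 2 * τ :=
    le_of_tendsto (tendsto_integral_mul_of_tendsto_eLpNorm hp (hDL j₀) (hgL j₀) (hg j₀)
      hφc.continuous φ.hasCompactSupport).abs (Filter.Eventually.of_forall hbound)
  -- The integral over `K` is its measure `4 * τ`, which an integral over `Kᶜ` of size at most `2 *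
  -- τ` cannot cancel.
  rw [hI1, hI2] at hG0
  have := neg_abs_le (∫ x in Kᶜ, g j₀ x * φ x)
  linarith

/-! ### The equivalence. -/

lemma Continuous.quasicontinuous {N : ℕ} (p : ℝ≥0∞) {u : RN N → ℝ} (hu : Continuous u) :
    Quasicontinuous p u := by
  refine ⟨hu.measurable.aemeasurable, fun ε hε => ⟨∅, isOpen_empty, ?_, hu.continuousOn⟩⟩
  refine lt_of_le_of_lt (iSup₂_le fun F hF => ?_) hε
  refine iInf₂_le_of_le (fun _ => 0) ⟨⟨contDiff_const, HasCompactSupport.zero, by simp⟩,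
    fun x hx => absurd (hF.2 hx) (by simp)⟩ ?_
  simp [sobolevNorm]

/-- In dimension zero there are no partial derivatives and the space is a single point; the
construction above needs a coordinate direction. -/
lemma memW_univ_of_isEmpty {p : ℝ≥0∞} (u : RN 0 → ℝ) : MemW p univ u := by
  refine ⟨?_, fun j => j.elim0⟩
  have h0 : u = fun _ => u 0 := funext fun x => by rw [Subsingleton.elim x 0]
  have hfin : IsFiniteMeasure ((volume : Measure (RN 0)).restrict univ) := by
    rw [Measure.restrict_univ]
    exact ⟨isCompact_univ_iff.2 inferInstance |>.measure_lt_top⟩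
  rw [h0]
  exact memLp_const _

/-- If `u` is in `W^{1,p}` off `K` but not on the whole space, then there is a counterexample to
removability that is singular on lines, which can be chosen to be `u` itself or continuous. -/
lemma MemW.exists_singularOnParallelLines {N : ℕ} {p : ℝ≥0∞} (hp : 1 ≤ p) (hp' : p ≠ ∞)
    {K : Set (RN N)} (hK : IsCompact K) {u : RN N → ℝ} (hc : ∀ v : RN N, v ≠ 0 →
        ContinuousOnLines v u)
    (hu : MemW p Kᶜ u) (hw : ¬ MemW p univ u) :
    ∃ f : RN N → ℝ, (f = u ∨ Continuous f) ∧ MemV p f ∧ MemW p Kᶜ f ∧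
        SingularOnParallelLines f := by
  rcases Nat.eq_zero_or_pos N with rfl | hN
  · exact absurd (memW_univ_of_isEmpty u) hw
  -- On a null `K` there is no derivative to control, so `u` itself serves. Otherwise `u` may lack
  -- pointwise derivatives on `K`, and the constructed continuous function replaces it.
  by_cases h0 : volume K = 0
  · have hr : (volume : Measure (RN N)).restrict Kᶜ = volume :=
      Measure.restrict_eq_self_of_ae_mem (measure_eq_zero_iff_ae_notMem.1 h0)
    have hV : MemV p u := hu.memV hp hK (by simpa only [hr] using hu.1) hc fun j =>
      ⟨0, MemLp.zero, (measure_eq_zero_iff_ae_notMem.1 h0).mono fun x hx hxK => absurd hxK hx⟩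
    exact ⟨u, Or.inl rfl, hV, hu, hV.singularOnParallelLines hp hc hw⟩
  · obtain ⟨f, hfc, hfV, hfW, hfn⟩ := exists_continuous_memV_not_memW hN hp hp' hK h0
    exact ⟨f, Or.inr hfc, hfV, hfW, hfV.singularOnParallelLines hp
      (fun v _ => Filter.Eventually.of_forall fun y => hfc.comp (by fun_prop)) hfn⟩

/-- `Q` must contain the continuous functions because the substitute counterexample is only known to
be continuous; continuity on lines is all else that is used of `Q`. -/
lemma removable_iff_not_exists_singular {N : ℕ} {p : ℝ≥0∞} (hp : 1 ≤ p) (hp' : p ≠ ∞)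
    {K : Set (RN N)} (hK : IsCompact K) {Q : (RN N → ℝ) → Prop}
    (hQ : ∀ u, Continuous u → Q u)
    (hQc : ∀ u, Q u → ∀ v : RN N, v ≠ 0 → ContinuousOnLines v u) :
    {u : RN N → ℝ | Q u ∧ MemW p Kᶜ u} = {u : RN N → ℝ | Q u ∧ MemW p univ u} ↔
      ¬ ∃ f : RN N → ℝ, Q f ∧ MemV p f ∧ MemW p Kᶜ f ∧ SingularOnParallelLines f := by
  constructor
  · rintro h ⟨f, hf, -, hfW, hfs⟩
    have : f ∈ {u : RN N → ℝ | Q u ∧ MemW p univ u} := h ▸ ⟨hf, hfW⟩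
    exact this.2.not_singularOnParallelLines hp (hQc f hf) hfs
  · intro h
    refine Subset.antisymm (fun u hu => ⟨hu.1, ?_⟩) fun u hu => ⟨hu.1, hu.2.mono_univ⟩
    by_contra hw
    obtain ⟨f, hf, hfV, hfW, hfs⟩ := hu.2.exists_singularOnParallelLines hp hp' hK (hQc u hu.1) hw
    refine h ⟨f, ?_, hfV, hfW, hfs⟩
    rcases hf with rfl | hf
    · exact hu.1
    · exact hQ f hf

theorem corollary1p7 (N : ℕ) (p : ℝ≥0∞) (hp : 1 ≤ p) (hp' : p ≠ ∞)
    (K : Set (RN N)) (hK : IsCompact K) :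
    (JProperty p K ↔
      ¬ ∃ f : RN N → ℝ, Quasicontinuous p f ∧ MemV p f ∧ MemW p Kᶜ f ∧
        SingularOnParallelLines f) ∧
    (JPropertyCont p K ↔
      ¬ ∃ f : RN N → ℝ, Continuous f ∧ MemV p f ∧ MemW p Kᶜ f ∧
        SingularOnParallelLines f) := by
  exact ⟨removable_iff_not_exists_singular hp hp' hK (fun _ hu => hu.quasicontinuous p)
      fun _ hu v hv => hu.continuousOnLines hp hp' v hv,
    removable_iff_not_exists_singular hp hp' hK (fun _ hu => hu)
      fun _ hu _ _ => Filter.Eventually.of_forall fun _ => hu.comp (by fun_prop)⟩
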